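/- Let base stations (BSs) form a homogeneous Poisson point process $\Phi=\{x_j\}$ of intensity $\lambda>0$ in $\mathbb R^2$, and let a typical user be at the origin. Let the path loss be $l(r)=Cr^{\alpha}$ with $C>0$, $\alpha\ge 2$, let $\Gamma_{cs}>0$ be the detection threshold, and assume there is no thermal noise. For an integer $M\ge1$ (the number of beams) divide the plane into the $M$ sectors $S_M(i)=\{x:\angle x\in[2\pi(i-1)/M,\,2\pi i/M)\}$, $1\le i\le M$. In the initial-access (IA) cycle $n=1,2,\dots$ let $F_j(n)$ be the fading of the link from $x_j$ to the user; the variables $F_j(n)$ are i.i.d. over all $j,n$, exponentially distributed with mean $1$ (Rayleigh fading), and independent of $\Phi$, while $\Phi$ is the same in all cycles. Sector $i$ is detected in cycle $n$ if the BS $x_0^i$ of $\Phi\cap S_M(i)$ with the smallest path loss, with fading $F_0^i(n)$, satisfies $$\frac{F_0^i(n)/l(\|x_0^i\|)}{\sum_{x_j\in\Phi\cap S_M(i)\setminus\{x_0^i\}}F_j(n)/l(\|x_j\|)}>\Gamma_{cs}.$$ Cell search succeeds in cycle $n$ if at least one of the $M$ sectors is detected in cycle $n$, and $L_{cs}(M)=\inf\{n\ge1:\text{cell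 search succeeds in cycle }n\}\in\mathbb N\cup\{\infty\}$ is the number of IA cycles needed. **Theorem.** The mean $\mathbb E[L_{cs}(M)]\in[1,\infty]$ is non-increasing in $M\ge1$, and: 1. If $\alpha>2+2\Gamma_{cs}$, then $\mathbb E[L_{cs}(M)]<\infty$ for every $M\ge1$. 2. If $\alpha\le 2+2\Gamma_{cs}$, then $\mathbb E[L_{cs}(1)]=\infty$. If moreover $\alpha>2$, then $\mathbb E[L_{cs}(M)]<\infty$ whenever $M>\frac{2\Gamma_{cs}}{\alpha-2}$, and there is an integer $M^*\in\bigl[1,\frac{2\Gamma_{cs}}{\alpha-2}\bigr]$ such that $\mathbb E[L_{cs}(M)]=\infty$ for $1\le M\le M^*$ and $\mathbb E[L_{cs}(M)]<\infty$ for all $M>M^*$. If $\alpha=2$, then $\mathbb E[L_{cs}(M)]=\infty$ for every $M\ge1$ (that is, $M^*=\infty$). -/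

import Mathlib

open MeasureTheory ProbabilityTheory
open scoped ENNReal NNReal

noncomputable section

namespace CellSearch

/-! The plane is identified with `ℂ` (with its Lebesgue measure `volume`); the typical user is at
the origin. A point process is given by an enumeration `X : ℕ → Ω → ℂ` of its points. -/

/-- The number of indices `j` with `X j ω ∈ B`: the number of points of the process in `B`. -/
def count {Ω : Type*} (X : ℕ → Ω → ℂ) (B : Set ℂ) (ω : Ω) : ℕ∞ :=
  Set.encard {j : ℕ | X j ω ∈ B}

/-- `(X j)_j` enumerates a homogeneous Poisson point process of intensity `lam` on the plane:
the number of points in a bounded Borel set `B` is Poisson distributed with mean `lam * |B|`, and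
the numbers of points in finitely many pairwise disjoint bounded Borel sets are independent. -/
structure IsPoissonProcess {Ω : Type*} [MeasurableSpace Ω] (P : Measure Ω)
    (lam : ℝ) (X : ℕ → Ω → ℂ) : Prop where
  measurable : ∀ j, Measurable (X j)
  poisson : ∀ B : Set ℂ, MeasurableSet B → Bornology.IsBounded B →
    HasLaw (count X B)
      ((poissonMeasure (lam * volume.real B).toNNReal).map (fun n : ℕ => (n : ℕ∞))) P
  indep : ∀ (m : ℕ) (B : Fin m → Set ℂ), (∀ i, MeasurableSet (B i)) →
    (∀ i, Bornology.IsBounded (B i)) → Pairwise (fun i j => Disjoint (B i) (B j)) →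
    iIndepFun (fun i => count X (B i)) P

/-- Rayleigh fading: `F n j` is the (power) fading in initial-access cycle `n` of the link from the
`j`-th base station to the typical user. All of these are i.i.d. exponential with unit mean, and
they are independent of the base station locations. -/
structure IsRayleighFading {Ω : Type*} [MeasurableSpace Ω] (P : Measure Ω)
    (X : ℕ → Ω → ℂ) (F : ℕ → ℕ → Ω → ℝ) : Prop where
  measurable : ∀ n j, Measurable (F n j)
  law : ∀ n j, HasLaw (F n j) (expMeasure 1) P
  iid : iIndepFun (fun p : ℕ × ℕ => F p.1 p.2) P
  indep_locations : IndepFun (fun ω (j : ℕ) => X j ω) (fun ω (p : ℕ × ℕ) => F p.1 p.2 ω) P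

/-- The polar angle in `[0, 2π)`. -/
def polarAngle (z : ℂ) : ℝ :=
  if 0 ≤ z.arg then z.arg else z.arg + 2 * Real.pi

/-- The `i`-th (counted from `0`) of the `M` base station sectors: the points whose angle lies in
`[2π i / M, 2π (i + 1) / M)`. -/
def sector (M : ℕ) (i : Fin M) : Set ℂ :=
  {z | polarAngle z ∈ Set.Ico (2 * Real.pi * (i : ℝ) / M) (2 * Real.pi * ((i : ℝ) + 1) / M)}

/-- The single-slope path loss `l(r) = C r ^ α`. -/
def pathLoss (C α r : ℝ) : ℝ := C * r ^ α

section
variable {Ω : Type*} (C α Γ : ℝ) (X : ℕ → Ω → ℂ) (F : ℕ → ℕ → Ω → ℝ)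

/-- The power received in cycle `n` from base station `j`, up to the common factor transmit
power times antenna gain, which cancels in the signal-to-interference ratio. -/
def receivedPower (n j : ℕ) (ω : Ω) : ℝ≥0∞ :=
  ENNReal.ofReal (F n j ω) / ENNReal.ofReal (pathLoss C α ‖X j ω‖)

/-- The interference to base station `j` in cycle `n` when the base stations located in `S` are the
ones received: the total power from all other base stations in `S` (possibly infinite). -/
def interference (S : Set ℂ) (n j : ℕ) (ω : Ω) : ℝ≥0∞ :=
  ∑' k : {k : ℕ // k ≠ j ∧ X k ω ∈ S}, receivedPower C α X F n k ω

/-- The signal-to-interference ratio of base station `j` in cycle `n` (no thermal noise). -/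
def sir (S : Set ℂ) (n j : ℕ) (ω : Ω) : ℝ≥0∞ :=
  receivedPower C α X F n j ω / interference C α X F S n j ω

/-- The sector `S` is detected in cycle `n`: the base station of smallest path loss in `S` has
signal-to-interference ratio above the threshold `Γ`. -/
def SectorDetected (S : Set ℂ) (n : ℕ) (ω : Ω) : Prop :=
  ∃ j : ℕ, X j ω ∈ S ∧
    (∀ k, X k ω ∈ S → pathLoss C α ‖X j ω‖ ≤ pathLoss C α ‖X k ω‖) ∧
    ENNReal.ofReal Γ < sir C α X F S n j ω

/-- Cell search succeeds in cycle `n` if at least one of the `M` sectors is detected. -/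
def Success (M n : ℕ) (ω : Ω) : Prop :=
  ∃ i : Fin M, SectorDetected C α Γ X F (sector M i) n ω

/-- The number `L_cs(M)` of initial-access cycles needed to succeed in cell search,
`inf {n ≥ 1 : success in cycle n}`, which is `⊤` if no cycle succeeds. -/
def numCycles (M : ℕ) (ω : Ω) : ℕ∞ :=
  sInf ((fun n : ℕ => (n : ℕ∞)) '' {n : ℕ | 1 ≤ n ∧ Success C α Γ X F M n ω})

/-- The mean number `E[L_cs(M)]` of initial-access cycles, in `[0, ∞]`. -/
def meanCycles [MeasurableSpace Ω] (P : Measure Ω) (M : ℕ) : ℝ≥0∞ :=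
  ∫⁻ ω, (numCycles C α Γ X F M ω : ℝ≥0∞) ∂P

end

end CellSearch

end

/-! Condition on the locations. If `x_j` is the nearest station of a sector `S`, exponential fading
turns the detection probability of `S` into `e^{-L}`, where `L = ∑ log (1 + Γ (‖x_j‖/‖x_k‖)^α)` runs
over the other stations of `S` (`logLoss`, `measure_sectorDetected`). Distinct sectors and cycles
use disjoint families of fading variables, so `N` failures in a row have conditional probability
`∏_i (1 - e^{-L_i})^N` (`measure_forall_not_success`).

`L` depends only on ratios of distances, and in the coordinate `c ‖z‖²` with `c = λπ/M` the stations
of each sector form a unit-rate Poisson process on the half-line. Hence the `L_i` are independent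
with a law that does not depend on `M`, and `E[L_cs(M)] = ∑_N q_N ^ M` with `q_N = E[(1 -
e^{-L})^N]` (`meanCycles_eq_tsum_missProb`). Here this is obtained by discretisation: the counts in
annular cells of equal area are i.i.d. Poisson, a function `cellLoss` of these counts converges to
`L` as the cells shrink, and the limits for `M` and for `1` are compared. Monotonicity in `M`
follows from `q_N ≤ 1`, and for `M = 1` the geometric series gives `E[e^L]`.

What remains concerns exponential moments of `L`. The nearest station lies at `c ‖x_j‖² = u` with
density `e^{-u}`, and given `u` the moment `E[e^{sL}]`, `0 < s ≤ 1`, is at most `exp (u s Γ / (α/2 -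
1))`, with equality for `s = 1`. So it is finite if `s Γ < α/2 - 1`
(`lintegral_expE_logLoss_lt_top`), and `E[e^L] = ∞` if `Γ ≥ α/2 - 1`
(`lintegral_expE_logLoss_eq_top`). As `q_N ≤ N^{-s} E[e^{sL}]`, the series converges once `s M > 1`;
a suitable `s` exists when `M > 1` and `M > 2Γ/(α - 2)`. For `α = 2` the sum defining `L` diverges
almost surely, and `q_N = 1`. -/

noncomputable section

namespace CellSearch

open Filter Topology

/-! ### The exponential on `[0, ∞]` and Poisson generating functions -/

/-- The exponential function on `[0, ∞]`. -/
def expE (t : ℝ≥0∞) : ℝ≥0∞ := EReal.exp (t : EReal)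

lemma expE_zero : expE 0 = 1 := by simp [expE]

lemma expE_top : expE ∞ = ∞ := by simp [expE]

lemma expE_add (a b : ℝ≥0∞) : expE (a + b) = expE a * expE b := by
  simp [expE, EReal.exp_add]

lemma expE_ofReal {x : ℝ} (hx : 0 ≤ x) : expE (ENNReal.ofReal x) = ENNReal.ofReal (Real.exp x) := by
  simp [expE, EReal.coe_ennreal_ofReal, max_eq_left hx]

lemma expE_mono : Monotone expE := fun a b h => by
  simpa [expE] using h

lemma one_le_expE (t : ℝ≥0∞) : 1 ≤ expE t := by
  rw [← expE_zero]; exact expE_mono zero_le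

lemma continuous_expE : Continuous expE :=
  ENNReal.continuous_exp.comp continuous_coe_ennreal_ereal

lemma measurable_expE : Measurable expE := continuous_expE.measurable

lemma inv_expE_le_one (t : ℝ≥0∞) : (expE t)⁻¹ ≤ 1 := ENNReal.inv_le_one.2 (one_le_expE t)

lemma expE_sum {ι : Type*} (s : Finset ι) (f : ι → ℝ≥0∞) :
    expE (∑ i ∈ s, f i) = ∏ i ∈ s, expE (f i) := by
  classical
  induction s using Finset.induction_on with
  | empty => simp [expE_zero]
  | insert a s ha ih => rw [Finset.sum_insert ha, Finset.prod_insert ha, expE_add, ih]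

lemma expE_mul_natCast (w : ℝ≥0∞) (n : ℕ) : expE (w * n) = expE w ^ n := by
  induction n with
  | zero => simp [expE_zero]
  | succ n ih => rw [pow_succ, ← ih, ← expE_add]; push_cast; rw [mul_add, mul_one]

lemma tendsto_expE_sum (f : ℕ → ℝ≥0∞) :
    Tendsto (fun K => expE (∑ i ∈ Finset.range K, f i)) atTop (𝓝 (expE (∑' i, f i))) :=
  (continuous_expE.tendsto _).comp (ENNReal.tendsto_nat_tsum f)

lemma lintegral_pow_poissonMeasure (r : ℝ≥0) {z : ℝ} (hz : 0 ≤ z) :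
    ∫⁻ n, ENNReal.ofReal z ^ n ∂(poissonMeasure r) = ENNReal.ofReal (Real.exp (r * (z - 1))) := by
  rw [lintegral_countable']
  have h1 : ∀ n : ℕ, ENNReal.ofReal z ^ n * poissonMeasure r {n} =
      ENNReal.ofReal (Real.exp (-r) * ((r * z) ^ n / n.factorial)) := fun n => by
    rw [poissonMeasure_singleton, ← ENNReal.ofReal_pow hz, ← ENNReal.ofReal_mul (by positivity)]
    congr 1
    rw [mul_pow]; ring
  simp_rw [h1]
  have h2 := (NormedSpace.expSeries_div_hasSum_exp ((r : ℝ) * z)).mul_left (Real.exp (-r))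
  rw [← Real.exp_eq_exp_ℝ] at h2
  rw [← ENNReal.ofReal_tsum_of_nonneg (fun n => by positivity) h2.summable, h2.tsum_eq,
    ← Real.exp_add]
  congr 2; ring

lemma poissonMeasure_singleton_zero (r : ℝ≥0) :
    poissonMeasure r {0} = ENNReal.ofReal (Real.exp (-r)) := by
  rw [poissonMeasure_singleton]; simp

/-! ### Independence by blocks, and counting as a series -/

/-- Disjoint blocks of independent σ-algebras are independent. This serves for fading variables
grouped by cycle and sector, for counts grouped by sector, and for single variables. -/
lemma lintegral_finsetProd_of_iIndep {Ω ι κ : Type*} {mΩ : MeasurableSpace Ω} {P : Measure Ω}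
    [IsProbabilityMeasure P] {m : ι → MeasurableSpace Ω} (hm : ∀ i, m i ≤ mΩ) (h : iIndep m P)
    {A : κ → Set ι} (hA : Pairwise (fun i j => Disjoint (A i) (A j))) {f : κ → Ω → ℝ≥0∞}
    (hf : ∀ k, Measurable[⨆ a ∈ A k, m a] (f k)) (s : Finset κ) :
    ∫⁻ ω, ∏ k ∈ s, f k ω ∂P = ∏ k ∈ s, ∫⁻ ω, f k ω ∂P := by
  classical
  induction s using Finset.induction_on with
  | empty => simp
  | insert a s ha ih =>
    simp_rw [Finset.prod_insert ha]
    rw [← ih]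
    have hd : Disjoint (A a) (⋃ k ∈ s, A k) := by
      rw [Set.disjoint_iUnion₂_right]
      exact fun k hk => hA (by rintro rfl; exact ha hk)
    have hle : ∀ T : Set ι, (⨆ b ∈ T, m b) ≤ mΩ := fun T => iSup₂_le fun b _ => hm b
    refine lintegral_mul_eq_lintegral_mul_lintegral_of_independent_measurableSpace
      (hle _) (hle _) (indep_iSup_of_disjoint hm h hd) (hf a) ?_
    refine Finset.measurable_fun_prod s fun k hk => (hf k).mono ?_ le_rfl
    exact biSup_mono fun b hb => Set.mem_biUnion hk hb

lemma measurable_biSup_comap {Ω ι β : Type*} [mβ : MeasurableSpace β] {G : ι → Ω → β} {A : Set ι}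
    {a : ι} (ha : a ∈ A) : Measurable[⨆ b ∈ A, MeasurableSpace.comap (G b) mβ] (G a) := by
  refine (comap_measurable (G a)).mono ?_ le_rfl
  exact le_iSup₂_of_le (f := fun b (_ : b ∈ A) => MeasurableSpace.comap (G b) mβ) a ha le_rfl

lemma tsum_ite_eq_encard_mul {ι : Type*} (s : Set ι) [DecidablePred (· ∈ s)] (c : ℝ≥0∞) :
    ∑' i, (if i ∈ s then c else 0) = (s.encard : ℝ≥0∞) * c := by
  rw [← ENNReal.tsum_set_const, tsum_subtype s (fun _ => c)]
  congr 1; ext i; simp [Set.indicator]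

lemma coe_enat_eq_tsum (c : ℕ∞) : (c : ℝ≥0∞) = ∑' n : ℕ, if (n : ℕ∞) < c then 1 else 0 := by
  classical
  have := tsum_ite_eq_encard_mul {n : ℕ | (n : ℕ∞) < c} 1
  simp only [Set.mem_ofPred_eq, mul_one] at this
  rw [this]
  congr 1
  cases c with
  | top => simp
  | coe c =>
    simp only [Nat.cast_lt]
    have : {n : ℕ | n < c} = (Finset.range c : Set ℕ) := by ext; simp
    rw [this, Set.encard_coe_eq_coe_finsetCard]; simp

/-! ### Geometry and area of the sectors -/

lemma measurable_polarAngle : Measurable polarAngle := by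
  unfold polarAngle
  exact Measurable.ite (measurableSet_le measurable_const Complex.measurable_arg)
    Complex.measurable_arg (Complex.measurable_arg.add_const _)

lemma polarAngle_nonneg (z : ℂ) : 0 ≤ polarAngle z := by
  unfold polarAngle
  split_ifs with h
  · exact h
  · linarith [Complex.neg_pi_lt_arg z, Real.pi_pos]

lemma polarAngle_lt (z : ℂ) : polarAngle z < 2 * Real.pi := by
  unfold polarAngle
  split_ifs with h
  · linarith [Complex.arg_le_pi z, Real.pi_pos]
  · linarith

lemma measurableSet_sector (M : ℕ) (i : Fin M) : MeasurableSet (sector M i) :=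
  measurable_polarAngle measurableSet_Ico

lemma sector_one (i : Fin 1) : sector 1 i = Set.univ := by
  ext z
  have : i = 0 := Subsingleton.elim _ _
  subst this
  simp [sector, polarAngle_nonneg, polarAngle_lt]

lemma disjoint_sector {M : ℕ} {i j : Fin M} (hij : i ≠ j) : Disjoint (sector M i) (sector M j) := by
  wlog h : i < j generalizing i j
  · exact (this hij.symm (lt_of_le_of_ne (not_lt.1 h) hij.symm)).symm
  rw [Set.disjoint_left]
  rintro z ⟨-, h1⟩ ⟨h2, -⟩
  have h3 : ((i : ℕ) : ℝ) + 1 ≤ (j : ℕ) := by exact_mod_cast h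
  have : 2 * Real.pi * (((i : ℕ) : ℝ) + 1) / M ≤ 2 * Real.pi * (j : ℕ) / M := by
    have := Real.pi_pos
    gcongr
  linarith

lemma polarAngle_polarCoord_symm {r θ : ℝ} (hr : 0 < r) (hθ : θ ∈ Set.Ioo (-Real.pi) Real.pi) :
    polarAngle (Complex.polarCoord.symm (r, θ)) = if 0 ≤ θ then θ else θ + 2 * Real.pi := by
  have : Complex.arg (Complex.polarCoord.symm (r, θ)) = θ := by
    rw [Complex.polarCoord_symm_apply]
    push_cast
    exact Complex.arg_mul_cos_add_sin_mul_I hr ⟨hθ.1, hθ.2.le⟩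
  rw [polarAngle, this]

/-- Polar coordinates cut the circle at `π`, the sectors cut it at `0`. The set is split
accordingly: angles above `π` come from negative `θ`, shifted by `2π`. -/
lemma volume_angles {a b : ℝ} (ha : 0 ≤ a) (hb : b ≤ 2 * Real.pi) :
    volume {θ : ℝ | θ ∈ Set.Ioo (-Real.pi) Real.pi ∧
      (if 0 ≤ θ then θ else θ + 2 * Real.pi) ∈ Set.Ico a b} = ENNReal.ofReal (b - a) := by
  have hpi := Real.pi_pos
  have e : {θ : ℝ | θ ∈ Set.Ioo (-Real.pi) Real.pi ∧
      (if 0 ≤ θ then θ else θ + 2 * Real.pi) ∈ Set.Ico a b} =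
      (Set.Ico a (min b Real.pi)) ∪
      ((fun θ => θ + 2 * Real.pi) ⁻¹' (Set.Ico a b ∩ Set.Ioo Real.pi (2 * Real.pi))) := by
    ext θ
    simp only [Set.mem_ofPred_eq, Set.mem_union, Set.mem_preimage, Set.mem_inter_iff, Set.mem_Ico,
      Set.mem_Ioo, lt_min_iff]
    split_ifs with h
    · constructor
      · rintro ⟨⟨h1, h2⟩, h3, h4⟩; exact Or.inl ⟨h3, h4, h2⟩
      · rintro (⟨h1, h2, h3⟩ | ⟨h1, h2⟩)
        · exact ⟨⟨by linarith, h3⟩, h1, h2⟩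
        · exfalso; linarith
    · constructor
      · rintro ⟨⟨h1, h2⟩, h3, h4⟩; exact Or.inr ⟨⟨h3, h4⟩, by linarith, by linarith⟩
      · rintro (⟨h1, h2, h3⟩ | ⟨h1, h2⟩)
        · exfalso; linarith
        · exact ⟨⟨by linarith, by linarith⟩, h1⟩
  have hd : Disjoint (Set.Ico a (min b Real.pi))
      ((fun θ => θ + 2 * Real.pi) ⁻¹' (Set.Ico a b ∩ Set.Ioo Real.pi (2 * Real.pi))) := by
    rw [Set.disjoint_left]
    rintro θ h1 h2
    have := h1.1
    have := h2.2.2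
    simp only [] at *
    linarith
  have hm : MeasurableSet ((fun θ => θ + 2 * Real.pi) ⁻¹'
      (Set.Ico a b ∩ Set.Ioo Real.pi (2 * Real.pi))) :=
    (measurable_id.add_const _) (measurableSet_Ico.inter measurableSet_Ioo)
  rw [e, measure_union hd hm, measure_preimage_add_right]
  have e2 : (Set.Ico a b ∩ Set.Ioo Real.pi (2 * Real.pi) : Set ℝ) =ᵐ[volume]
      (Set.Ico (max a Real.pi) b : Set ℝ) := by
    have h1 : (Set.Ico a b ∩ Set.Ioo Real.pi (2 * Real.pi) : Set ℝ) =ᵐ[volume]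
      (Set.Ico a b ∩ Set.Ico Real.pi (2 * Real.pi) : Set ℝ) :=
      (ae_eq_refl _).inter Ioo_ae_eq_Ico
    refine h1.trans (Eq.eventuallyEq ?_)
    rw [Set.Ico_inter_Ico, min_eq_left hb]
  rw [measure_congr e2, Real.volume_Ico, Real.volume_Ico]
  rcases le_total b Real.pi with h | h
  · rw [min_eq_left h, ENNReal.ofReal_of_nonpos (p := b - max a Real.pi), add_zero]
    linarith [le_max_right a Real.pi]
  · rw [min_eq_right h]
    rcases le_total a Real.pi with h' | h'
    · rw [max_eq_right h', ← ENNReal.ofReal_add (by linarith) (by linarith)]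
      congr 1; ring
    · rw [max_eq_left h', ENNReal.ofReal_of_nonpos (by linarith), zero_add]

lemma lintegral_radii {a b : ℝ} (ha : 0 ≤ a) (hab : a ≤ b) :
    ∫⁻ r in Set.Ioi (0 : ℝ), ENNReal.ofReal r * Set.indicator {r : ℝ | a ≤ r ^ 2 ∧ r ^ 2 < b} 1 r =
      ENNReal.ofReal ((b - a) / 2) := by
  have hs : Real.sqrt a ≤ Real.sqrt b := Real.sqrt_le_sqrt hab
  have hm : MeasurableSet {r : ℝ | a ≤ r ^ 2 ∧ r ^ 2 < b} :=
    (measurableSet_le measurable_const (measurable_id.pow_const 2)).inter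
      (measurableSet_lt (measurable_id.pow_const 2) measurable_const)
  have h1 : ∀ r : ℝ, ENNReal.ofReal r * Set.indicator {r : ℝ | a ≤ r ^ 2 ∧ r ^ 2 < b} 1 r =
      Set.indicator {r : ℝ | a ≤ r ^ 2 ∧ r ^ 2 < b} (fun r => ENNReal.ofReal r) r := fun r => by
    by_cases h : r ∈ {r : ℝ | a ≤ r ^ 2 ∧ r ^ 2 < b}
    · rw [Set.indicator_of_mem h, Set.indicator_of_mem h]; simp
    · rw [Set.indicator_of_notMem h, Set.indicator_of_notMem h]; simp
  simp_rw [h1]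
  rw [lintegral_indicator hm, Measure.restrict_restrict hm]
  have e : ({r : ℝ | a ≤ r ^ 2 ∧ r ^ 2 < b} ∩ Set.Ioi 0 : Set ℝ) =ᵐ[volume]
      (Set.Ioc (Real.sqrt a) (Real.sqrt b) : Set ℝ) := by
    have h2 : ({r : ℝ | a ≤ r ^ 2 ∧ r ^ 2 < b} ∩ Set.Ioi 0 : Set ℝ) =
        (Set.Ico (Real.sqrt a) (Real.sqrt b) ∩ Set.Ioi 0 : Set ℝ) := by
      ext r
      simp only [Set.mem_inter_iff, Set.mem_ofPred_eq, Set.mem_Ioi, Set.mem_Ico]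
      refine and_congr_left fun hr => ?_
      rw [Real.sqrt_le_left hr.le, Real.lt_sqrt hr.le]
    have h3 : (Set.Ioi (0:ℝ) : Set ℝ) =ᵐ[volume] (Set.Ici 0 : Set ℝ) := Ioi_ae_eq_Ici
    have h4 : (Set.Ico (Real.sqrt a) (Real.sqrt b) ∩ Set.Ici 0 : Set ℝ) =
        Set.Ico (Real.sqrt a) (Real.sqrt b) :=
      Set.inter_eq_left.2 fun r hr => (Real.sqrt_nonneg a).trans hr.1
    rw [h2]
    refine ((ae_eq_refl _).inter h3).trans ?_
    rw [h4]
    exact Ico_ae_eq_Ioc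
  rw [Measure.restrict_congr_set e, ← ofReal_integral_eq_lintegral_ofReal,
    ← intervalIntegral.integral_of_le hs, integral_id, Real.sq_sqrt ha, Real.sq_sqrt (ha.trans hab)]
  · exact (continuous_id.integrableOn_Icc).mono_set Set.Ioc_subset_Icc_self
  · refine (ae_restrict_iff' measurableSet_Ioc).2 (ae_of_all _ fun r hr => ?_)
    exact (Real.sqrt_nonneg a).trans hr.1.le

/-- The area is linear in the squared radius, which is why the cells below are equally spaced in
`‖z‖ ^ 2`. -/
lemma volume_sector_inter_annulus {M : ℕ} (hM : 1 ≤ M) (i : Fin M) {a b : ℝ} (ha : 0 ≤ a)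
    (hab : a ≤ b) :
    volume (sector M i ∩ {z : ℂ | a ≤ ‖z‖ ^ 2 ∧ ‖z‖ ^ 2 < b}) =
      ENNReal.ofReal ((b - a) * Real.pi / M) := by
  have hpi := Real.pi_pos
  have hM' : (0 : ℝ) < M := by exact_mod_cast hM
  set A := 2 * Real.pi * ((i : ℕ) : ℝ) / M with hA
  set B := 2 * Real.pi * (((i : ℕ) : ℝ) + 1) / M with hB
  have hA0 : 0 ≤ A := by positivity
  have hAB : A ≤ B := by rw [hA, hB]; gcongr; linarith
  have hB2 : B ≤ 2 * Real.pi := by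
    rw [hB, div_le_iff₀ hM']
    have : (((i : ℕ) : ℝ) + 1) ≤ M := by exact_mod_cast i.2
    gcongr
  have hmR : MeasurableSet {z : ℂ | a ≤ ‖z‖ ^ 2 ∧ ‖z‖ ^ 2 < b} :=
    (measurableSet_le measurable_const (measurable_norm.pow_const 2)).inter
      (measurableSet_lt (measurable_norm.pow_const 2) measurable_const)
  have hmS : MeasurableSet (sector M i ∩ {z : ℂ | a ≤ ‖z‖ ^ 2 ∧ ‖z‖ ^ 2 < b}) :=
    (measurableSet_sector M i).inter hmR
  rw [← lintegral_indicator_one hmS, ← Complex.lintegral_comp_polarCoord_symm]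
  have hT : polarCoord.target = Set.Ioi (0 : ℝ) ×ˢ Set.Ioo (-Real.pi) Real.pi := rfl
  rw [hT]
  set R : Set ℝ := {r : ℝ | a ≤ r ^ 2 ∧ r ^ 2 < b} with hR
  set T : Set ℝ := {θ : ℝ | θ ∈ Set.Ioo (-Real.pi) Real.pi ∧
      (if 0 ≤ θ then θ else θ + 2 * Real.pi) ∈ Set.Ico A B} with hTT
  have hmRR : MeasurableSet R :=
    (measurableSet_le measurable_const (measurable_id.pow_const 2)).inter
      (measurableSet_lt (measurable_id.pow_const 2) measurable_const)
  have hmT : MeasurableSet T := by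
    refine measurableSet_Ioo.inter ?_
    have : Measurable fun θ : ℝ => if 0 ≤ θ then θ else θ + 2 * Real.pi :=
      Measurable.ite measurableSet_Ici measurable_id (measurable_id.add_const _)
    exact this measurableSet_Ico
  have hcongr : ∫⁻ p in Set.Ioi (0 : ℝ) ×ˢ Set.Ioo (-Real.pi) Real.pi, ENNReal.ofReal p.1 •
      Set.indicator (sector M i ∩ {z : ℂ | a ≤ ‖z‖ ^ 2 ∧ ‖z‖ ^ 2 < b}) (1 : ℂ → ℝ≥0∞)
        (Complex.polarCoord.symm p) =
      ∫⁻ p in Set.Ioi (0 : ℝ) ×ˢ Set.Ioo (-Real.pi) Real.pi,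
        (ENNReal.ofReal p.1 * R.indicator 1 p.1) * T.indicator 1 p.2 := by
    refine setLIntegral_congr_fun (measurableSet_Ioi.prod measurableSet_Ioo) ?_
    rintro ⟨r, θ⟩ ⟨hr, hθ⟩
    simp only [Set.mem_Ioi] at hr
    have h1 : Complex.polarCoord.symm (r, θ) ∈
        sector M i ∩ {z : ℂ | a ≤ ‖z‖ ^ 2 ∧ ‖z‖ ^ 2 < b} ↔ θ ∈ T ∧ r ∈ R := by
      refine and_congr ?_ ?_
      · change polarAngle _ ∈ Set.Ico A B ↔ _
        rw [polarAngle_polarCoord_symm hr hθ]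
        exact ⟨fun h => ⟨hθ, h⟩, fun h => h.2⟩
      · change a ≤ ‖_‖ ^ 2 ∧ ‖_‖ ^ 2 < b ↔ _
        rw [Complex.norm_polarCoord_symm, abs_of_pos hr]; rfl
    change ENNReal.ofReal r * _ = ENNReal.ofReal r * R.indicator 1 r * T.indicator 1 θ
    by_cases h2 : θ ∈ T ∧ r ∈ R
    · rw [Set.indicator_of_mem (h1.2 h2), Set.indicator_of_mem h2.1, Set.indicator_of_mem h2.2]
      simp
    · rw [Set.indicator_of_notMem (mt h1.1 h2)]
      rcases not_and_or.1 h2 with h3 | h3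
      · rw [Set.indicator_of_notMem h3]; simp
      · rw [Set.indicator_of_notMem h3]; simp
  rw [hcongr, Measure.volume_eq_prod, ← Measure.prod_restrict,
    lintegral_prod_mul (f := fun r : ℝ => ENNReal.ofReal r * R.indicator 1 r)
      (g := fun θ : ℝ => T.indicator 1 θ) ?_ ?_, lintegral_radii ha hab]
  · rw [lintegral_indicator_one hmT, Measure.restrict_apply hmT,
      Set.inter_eq_left.2 (fun θ hθ => hθ.1), volume_angles hA0 hB2,
      ← ENNReal.ofReal_mul (by linarith)]
    congr 1
    rw [hA, hB]
    field_simp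
    ring
  · exact (ENNReal.measurable_ofReal.mul (measurable_one.indicator hmRR)).aemeasurable
  · exact (measurable_one.indicator hmT).aemeasurable

/-! ### Laplace transforms of exponential fading -/

lemma inv_expE_add (a b : ℝ≥0∞) : (expE (a + b))⁻¹ = (expE a)⁻¹ * (expE b)⁻¹ := by
  have h : ∀ t, expE t ≠ 0 := fun t => (zero_lt_one.trans_le (one_le_expE t)).ne'
  rw [expE_add, ENNReal.mul_inv (Or.inl (h _)) (Or.inr (h _))]

lemma inv_expE_sum {ι : Type*} (s : Finset ι) (f : ι → ℝ≥0∞) :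
    (expE (∑ i ∈ s, f i))⁻¹ = ∏ i ∈ s, (expE (f i))⁻¹ := by
  classical
  induction s using Finset.induction_on with
  | empty => simp [expE_zero]
  | insert a s ha ih => rw [Finset.sum_insert ha, Finset.prod_insert ha, inv_expE_add, ih]

lemma measurable_inv_expE : Measurable fun t => (expE t)⁻¹ := measurable_expE.inv

lemma expMeasure_lt_ofReal (t : ℝ≥0∞) :
    expMeasure 1 {y | t < ENNReal.ofReal y} = (expE t)⁻¹ := by
  have := isProbabilityMeasure_expMeasure (r := 1) one_pos
  induction t with
  | top => simp [expE_top]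
  | coe r =>
    have h1 : {y : ℝ | (r : ℝ≥0∞) < ENNReal.ofReal y} = (Set.Iic (r : ℝ))ᶜ := by
      ext y
      simp only [Set.mem_ofPred_eq, Set.mem_compl_iff, Set.mem_Iic, not_le]
      rw [← ENNReal.ofReal_coe_nnreal, ENNReal.ofReal_lt_ofReal_iff_of_nonneg r.coe_nonneg]
    have h2 := cdf_expMeasure_eq (r := 1) one_pos (r : ℝ)
    rw [cdf_eq_real, if_pos r.coe_nonneg, one_mul] at h2
    rw [h1, prob_compl_eq_one_sub measurableSet_Iic, ← ofReal_measureReal, h2,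
      ← ENNReal.ofReal_coe_nnreal, expE_ofReal r.coe_nonneg, ← ENNReal.ofReal_inv_of_pos (Real.exp_pos _),
      ← Real.exp_neg, ← ENNReal.ofReal_one, ← ENNReal.ofReal_sub _ (by simp)]
    congr 1; ring

/-- The Laplace transform `1 / (1 + t)` is kept in the form `e^{-log (1 + t)}`, so that infinite
products become sums in the exponent, where the value `∞` is harmless. -/
lemma lintegral_inv_expE_expMeasure {t : ℝ} (ht : 0 ≤ t) :
    ∫⁻ y, (expE (ENNReal.ofReal t * ENNReal.ofReal y))⁻¹ ∂(expMeasure 1) =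
      (expE (ENNReal.ofReal (Real.log (1 + t))))⁻¹ := by
  have h1 : (0 : ℝ) < 1 + t := by linarith
  rw [expE_ofReal (Real.log_nonneg (by linarith)), Real.exp_log h1]
  have hd : expMeasure 1 = volume.withDensity (exponentialPDF 1) := rfl
  have hm : Measurable (exponentialPDF 1) :=
    (measurable_exponentialPDFReal 1).ennreal_ofReal
  rw [hd, lintegral_withDensity_eq_lintegral_mul _ hm (g := fun y =>
    (expE (ENNReal.ofReal t * ENNReal.ofReal y))⁻¹)
    (measurable_inv_expE.comp (ENNReal.measurable_ofReal.const_mul _))]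
  have h2 : ∀ y, (exponentialPDF 1 * fun y => (expE (ENNReal.ofReal t * ENNReal.ofReal y))⁻¹) y =
      ENNReal.ofReal (1 + t)⁻¹ * exponentialPDF (1 + t) y := fun y => by
    simp only [Pi.mul_apply]
    rcases lt_or_ge y 0 with hy | hy
    · rw [exponentialPDF_of_neg hy, exponentialPDF_of_neg hy]; simp
    · rw [exponentialPDF_of_nonneg hy, exponentialPDF_of_nonneg hy, ← ENNReal.ofReal_mul ht,
        expE_ofReal (by positivity), ← ENNReal.ofReal_inv_of_pos (Real.exp_pos _),
        ← ENNReal.ofReal_mul (by positivity), ← ENNReal.ofReal_mul (by positivity), ← Real.exp_neg,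
        ← mul_assoc, inv_mul_cancel₀ h1.ne', mul_assoc, ← Real.exp_add]
      congr 3; ring
  rw [lintegral_congr h2, lintegral_const_mul (f := exponentialPDF (1 + t)) _
      (measurable_exponentialPDFReal _).ennreal_ofReal,
    lintegral_exponentialPDF_eq_one h1, mul_one, ENNReal.ofReal_inv_of_pos h1]

section
variable {Ω : Type*} [mΩ : MeasurableSpace Ω] {P : Measure Ω} [IsProbabilityMeasure P]

lemma measure_lt_ofReal_of_indepFun {T : Ω → ℝ≥0∞} {G : Ω → ℝ} (hT : Measurable T)
    (hGm : Measurable G) (hG : HasLaw G (expMeasure 1) P) (hTG : IndepFun T G P) :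
    P {ω | T ω < ENNReal.ofReal (G ω)} = ∫⁻ ω, (expE (T ω))⁻¹ ∂P := by
  have := isProbabilityMeasure_expMeasure (r := 1) one_pos
  have h1 := (indepFun_iff_map_prod_eq_prod_map_map hT.aemeasurable hGm.aemeasurable).1 hTG
  have hm : MeasurableSet {p : ℝ≥0∞ × ℝ | p.1 < ENNReal.ofReal p.2} :=
    measurableSet_lt measurable_fst (ENNReal.measurable_ofReal.comp measurable_snd)
  have h2 : P {ω | T ω < ENNReal.ofReal (G ω)} =
      P.map (fun ω => (T ω, G ω)) {p : ℝ≥0∞ × ℝ | p.1 < ENNReal.ofReal p.2} := by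
    rw [Measure.map_apply (hT.prodMk hGm) hm]; rfl
  rw [h2, h1, hG.map_eq, Measure.prod_apply hm, lintegral_map (measurable_measure_prodMk_left hm) hT]
  exact lintegral_congr fun ω => expMeasure_lt_ofReal (T ω)

/-- Finite partial sums factor by independence; the limit is dominated by `1`. No summability is
needed: if the logarithms diverge, both sides are `0`. -/
lemma lintegral_inv_expE_tsum {G : ℕ → Ω → ℝ} (hGm : ∀ k, Measurable (G k))
    (hG : ∀ k, HasLaw (G k) (expMeasure 1) P) (hi : iIndepFun G P) {t : ℕ → ℝ}
    (ht : ∀ k, 0 ≤ t k) :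
    ∫⁻ ω, (expE (∑' k, ENNReal.ofReal (t k) * ENNReal.ofReal (G k ω)))⁻¹ ∂P =
      (expE (∑' k, ENNReal.ofReal (Real.log (1 + t k))))⁻¹ := by
  have hmt : ∀ k, Measurable fun y : ℝ => ENNReal.ofReal (t k) * ENNReal.ofReal y :=
    fun k => ENNReal.measurable_ofReal.const_mul _
  have hfin : ∀ K, ∫⁻ ω, (expE (∑ k ∈ Finset.range K,
      ENNReal.ofReal (t k) * ENNReal.ofReal (G k ω)))⁻¹ ∂P =
      (expE (∑ k ∈ Finset.range K, ENNReal.ofReal (Real.log (1 + t k))))⁻¹ := fun K => by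
    simp_rw [inv_expE_sum]
    have := lintegral_finsetProd_of_iIndep (P := P) (A := fun k => ({k} : Set ℕ))
      (fun k => (hGm k).comap_le) hi
      (f := fun k ω => (expE (ENNReal.ofReal (t k) * ENNReal.ofReal (G k ω)))⁻¹)
      (fun i j hij => Set.disjoint_singleton.2 hij) (fun k => ?_) (Finset.range K)
    · rw [this]
      refine Finset.prod_congr rfl fun k _ => ?_
      rw [← lintegral_inv_expE_expMeasure (ht k)]
      exact (hG k).lintegral_comp (f := fun y => (expE (ENNReal.ofReal (t k) * ENNReal.ofReal y))⁻¹)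
        (measurable_inv_expE.comp (hmt k)).aemeasurable
    · exact (measurable_inv_expE.comp (hmt k)).comp (measurable_biSup_comap rfl)
  have h1 : Tendsto (fun K => ∫⁻ ω, (expE (∑ k ∈ Finset.range K,
      ENNReal.ofReal (t k) * ENNReal.ofReal (G k ω)))⁻¹ ∂P) atTop
      (𝓝 (∫⁻ ω, (expE (∑' k, ENNReal.ofReal (t k) * ENNReal.ofReal (G k ω)))⁻¹ ∂P)) := by
    refine tendsto_lintegral_of_dominated_convergence (fun _ => 1) (fun K => ?_)
      (fun K => ae_of_all _ fun ω => inv_expE_le_one _) (by simp) (ae_of_all _ fun ω => ?_)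
    · exact measurable_inv_expE.comp (Finset.measurable_fun_sum _ fun k _ => (hmt k).comp (hGm k))
    · exact (continuous_inv.tendsto (_ : ℝ≥0∞)).comp (tendsto_expE_sum _)
  simp_rw [hfin] at h1
  exact tendsto_nhds_unique h1 ((continuous_inv.tendsto (_ : ℝ≥0∞)).comp (tendsto_expE_sum _))

end

/-! ### Detection for fixed locations -/

/-- `j` is the index of a point of minimal norm in `S`. -/
def IsNearest (x : ℕ → ℂ) (S : Set ℂ) (j : ℕ) : Prop :=
  x j ∈ S ∧ ∀ k, x k ∈ S → ‖x j‖ ≤ ‖x k‖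

open Classical in
/-- The negative logarithm of the probability that `j` exceeds the threshold `Γ`, given the
locations. -/
def logLossAt (α Γ : ℝ) (S : Set ℂ) (x : ℕ → ℂ) (j : ℕ) : ℝ≥0∞ :=
  ∑' k, if k ≠ j ∧ x k ∈ S then
    ENNReal.ofReal (Real.log (1 + Γ * (‖x j‖ / ‖x k‖) ^ α)) else 0

open Classical in
/-- The negative logarithm of the detection probability of `S` given the locations. -/
def logLoss (α Γ : ℝ) (S : Set ℂ) (x : ℕ → ℂ) : ℝ≥0∞ :=
  ∑' j, if IsNearest x S j then logLossAt α Γ S x j else 0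

/-- No point at the origin, and a unique nearest point in `S`. -/
structure IsRegular (x : ℕ → ℂ) (S : Set ℂ) : Prop where
  ne_zero : ∀ j, x j ≠ 0
  existsUnique : ∃! j, IsNearest x S j

lemma logLoss_eq {α Γ : ℝ} {S : Set ℂ} {x : ℕ → ℂ} (h : ∃! j, IsNearest x S j) {j : ℕ}
    (hj : IsNearest x S j) : logLoss α Γ S x = logLossAt α Γ S x j := by
  classical
  rw [logLoss, tsum_eq_single j, if_pos hj]
  intro k hk
  rw [if_neg fun h' => hk (h.unique h' hj)]

lemma pathLoss_pos {C α r : ℝ} (hC : 0 < C) (hr : 0 < r) : 0 < pathLoss C α r :=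
  mul_pos hC (Real.rpow_pos_of_pos hr α)

lemma pathLoss_le_iff {C α r s : ℝ} (hC : 0 < C) (hα : 0 < α) (hr : 0 ≤ r) (hs : 0 ≤ s) :
    pathLoss C α r ≤ pathLoss C α s ↔ r ≤ s := by
  rw [pathLoss, pathLoss, mul_le_mul_iff_right₀ hC, Real.rpow_le_rpow_iff hr hs hα]

section
variable {Ω : Type*} {C α Γ : ℝ} {x : ℕ → ℂ} {F : ℕ → ℕ → Ω → ℝ} {S : Set ℂ}

lemma sectorDetected_iff (hC : 0 < C) (hα : 0 < α) (h : ∃! j, IsNearest x S j) {j : ℕ}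
    (hj : IsNearest x S j) (n : ℕ) (ω : Ω) :
    SectorDetected C α Γ (fun k _ => x k) F S n ω ↔
      ENNReal.ofReal Γ < sir C α (fun k _ => x k) F S n j ω := by
  constructor
  · rintro ⟨k, hk, hk', hs⟩
    have : IsNearest x S k := ⟨hk, fun l hl =>
      (pathLoss_le_iff hC hα (norm_nonneg _) (norm_nonneg _)).1 (hk' l hl)⟩
    rwa [h.unique this hj] at hs
  · exact fun hs => ⟨j, hj.1, fun l hl =>
      (pathLoss_le_iff hC hα (norm_nonneg _) (norm_nonneg _)).2 (hj.2 l hl), hs⟩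

/-- Measurability is asked only of the fadings of points in `S`, so that the lemma applies to the
σ-algebra generated by the fadings of one sector in one cycle. -/
lemma measurableSet_sectorDetected [MeasurableSpace Ω] (hC : 0 < C) (hα : 0 < α)
    (h : ∃! j, IsNearest x S j) {n : ℕ} (hF : ∀ k, x k ∈ S → Measurable (F n k)) :
    MeasurableSet {ω | SectorDetected C α Γ (fun k _ => x k) F S n ω} := by
  obtain ⟨j, hj, -⟩ := id h
  simp_rw [sectorDetected_iff hC hα h hj]
  have hr : ∀ k, x k ∈ S → Measurable fun ω => receivedPower C α (fun k _ => x k) F n k ω :=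
    fun k hk => (hF k hk).ennreal_ofReal.div_const _
  refine measurableSet_lt measurable_const ((hr j hj.1).div ?_)
  exact Measurable.tsum fun k : {k : ℕ // k ≠ j ∧ x k ∈ S} => hr k k.2.2

-- As `Γ` is neither `0` nor `∞`, the denominator can be cleared even if the interference is `0` or
-- `∞`. The constant `C` cancels in the ratio of path losses.
open Classical in
lemma lt_sir_iff (hC : 0 < C) (hΓ : 0 < Γ) (hx : ∀ j, x j ≠ 0) {n j : ℕ} {ω : Ω}
    (hF : 0 < F n j ω) :
    ENNReal.ofReal Γ < sir C α (fun k _ => x k) F S n j ω ↔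
      ∑' k, ENNReal.ofReal (if k ≠ j ∧ x k ∈ S then Γ * (‖x j‖ / ‖x k‖) ^ α else 0) *
        ENNReal.ofReal (F n k ω) < ENNReal.ofReal (F n j ω) := by
  have hl : ∀ k, 0 < pathLoss C α ‖x k‖ := fun k => pathLoss_pos hC (norm_pos_iff.2 (hx k))
  set l0 := ENNReal.ofReal (pathLoss C α ‖x j‖) with hl0
  have hl00 : l0 ≠ 0 := by simpa [hl0] using hl j
  have hl0t : l0 ≠ ∞ := ENNReal.ofReal_ne_top
  have hR0 : receivedPower C α (fun k _ => x k) F n j ω ≠ 0 :=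
    ENNReal.div_ne_zero.2 ⟨by simpa using hF, hl0t⟩
  have hRt : receivedPower C α (fun k _ => x k) F n j ω ≠ ∞ :=
    ENNReal.div_ne_top ENNReal.ofReal_ne_top hl00
  have hI : interference C α (fun k _ => x k) F S n j ω = ∑' k, Set.indicator
      {k : ℕ | k ≠ j ∧ x k ∈ S} (fun k => receivedPower C α (fun k _ => x k) F n k ω) k :=
    tsum_subtype {k : ℕ | k ≠ j ∧ x k ∈ S} (fun k => receivedPower C α (fun k _ => x k) F n k ω)
  rw [sir, ENNReal.lt_div_iff_mul_lt (c := ENNReal.ofReal Γ) (Or.inr ENNReal.ofReal_ne_top)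
      (Or.inr (by simpa using hΓ)),
    receivedPower, ENNReal.lt_div_iff_mul_lt (Or.inl hl00) (Or.inl hl0t), hI,
    ← ENNReal.tsum_mul_left, ← ENNReal.tsum_mul_right]
  have : ∀ k, ENNReal.ofReal Γ * Set.indicator {k : ℕ | k ≠ j ∧ x k ∈ S}
      (fun k => receivedPower C α (fun k _ => x k) F n k ω) k * l0 =
      ENNReal.ofReal (if k ≠ j ∧ x k ∈ S then Γ * (‖x j‖ / ‖x k‖) ^ α else 0) *
        ENNReal.ofReal (F n k ω) := fun k => by
    by_cases hk : k ≠ j ∧ x k ∈ S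
    · rw [if_pos hk, Set.indicator_of_mem (show k ∈ {k : ℕ | k ≠ j ∧ x k ∈ S} from hk),
        receivedPower, ENNReal.div_eq_inv_mul, ← ENNReal.ofReal_inv_of_pos (hl k)]
      have e : Γ * (‖x j‖ / ‖x k‖) ^ α =
          Γ * ((pathLoss C α ‖x k‖)⁻¹ * pathLoss C α ‖x j‖) := by
        have := Real.rpow_pos_of_pos (norm_pos_iff.2 (hx k)) α
        rw [Real.div_rpow (norm_nonneg _) (norm_nonneg _), pathLoss, pathLoss]
        field_simp
      rw [e, ENNReal.ofReal_mul hΓ.le, ENNReal.ofReal_mul (inv_nonneg.2 (hl k).le)]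
      ring
    · rw [if_neg hk, Set.indicator_of_notMem (show k ∉ {k : ℕ | k ≠ j ∧ x k ∈ S} from hk)]
      simp
  rw [tsum_congr this]

lemma measurable_indicator_compl_one [MeasurableSpace Ω] {D : Set Ω} (hD : MeasurableSet D) :
    Measurable (Dᶜ.indicator (1 : Ω → ℝ≥0∞)) := measurable_one.indicator hD.compl

lemma measurable_tsum_ofReal_mul [MeasurableSpace Ω] {G : ℕ → Ω → ℝ} {t : ℕ → ℝ}
    (hG : ∀ k, t k ≠ 0 → Measurable (G k)) :
    Measurable fun ω => ∑' k, ENNReal.ofReal (t k) * ENNReal.ofReal (G k ω) := by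
  refine Measurable.tsum fun k => ?_
  by_cases hk : t k = 0
  · simp [hk]
  · exact (hG k hk).ennreal_ofReal.const_mul _

/-- Given the interference, the exponential tail of `F n j` yields `e^{-T}` with `T` the normalised
interference. Averaging `e^{-T}` is a Laplace transform, which factors over the interferers. -/
lemma measure_sectorDetected [MeasurableSpace Ω] {P : Measure Ω} [IsProbabilityMeasure P]
    (hC : 0 < C) (hα : 0 < α) (hΓ : 0 < Γ) (hx : IsRegular x S) {n : ℕ}
    (hF : ∀ k, Measurable (F n k)) (hl : ∀ k, HasLaw (F n k) (expMeasure 1) P)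
    (hi : iIndepFun (F n) P) :
    P {ω | SectorDetected C α Γ (fun k _ => x k) F S n ω} = (expE (logLoss α Γ S x))⁻¹ := by
  classical
  obtain ⟨j, hj, -⟩ := hx.existsUnique
  have ht : ∀ k, 0 ≤ if k ≠ j ∧ x k ∈ S then Γ * (‖x j‖ / ‖x k‖) ^ α else 0 := fun k => by
    split_ifs <;> positivity
  have hpos : ∀ᵐ ω ∂P, 0 < F n j ω := by
    have h0 : P {ω | 0 < F n j ω} = 1 := by
      rw [(hl j).measure_eq (p := fun y => 0 < y) measurableSet_Ioi]
      simpa [expE_zero] using expMeasure_lt_ofReal 0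
    exact (prob_compl_eq_zero_iff (measurableSet_lt measurable_const (hF j))).2 h0
  have h1 : P {ω | SectorDetected C α Γ (fun k _ => x k) F S n ω} =
      P {ω | ∑' k, ENNReal.ofReal (if k ≠ j ∧ x k ∈ S then Γ * (‖x j‖ / ‖x k‖) ^ α else 0) *
        ENNReal.ofReal (F n k ω) < ENNReal.ofReal (F n j ω)} := by
    refine measure_congr (hpos.mono fun ω hω => ?_)
    refine propext ?_
    exact (sectorDetected_iff hC hα hx.existsUnique hj n ω).trans (lt_sir_iff hC hΓ hx.ne_zero hω)
  have hm : ∀ k, Measurable fun y : ℝ => ENNReal.ofReal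
      (if k ≠ j ∧ x k ∈ S then Γ * (‖x j‖ / ‖x k‖) ^ α else 0) * ENNReal.ofReal y :=
    fun k => ENNReal.measurable_ofReal.const_mul _
  rw [h1, measure_lt_ofReal_of_indepFun (T := fun ω => ∑' k, ENNReal.ofReal
    (if k ≠ j ∧ x k ∈ S then Γ * (‖x j‖ / ‖x k‖) ^ α else 0) * ENNReal.ofReal (F n k ω))
    (Measurable.tsum fun k => (hm k).comp (hF k)) (hF j) (hl j) ?_, lintegral_inv_expE_tsum hF hl hi ht, logLoss_eq hx.existsUnique hj, logLossAt]
  · congr 2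
    refine tsum_congr fun k => ?_
    split_ifs <;> simp
  -- The weight of index `j` in the interference is zero, so the interference is measurable with
  -- respect to the fadings of the other indices.
  · have hd : Disjoint {k : ℕ | k ≠ j} {j} := by simp
    have := indep_iSup_of_disjoint (fun k => (hF k).comap_le) hi hd
    refine (IndepFun_iff_Indep _ _ _).2 (indep_of_indep_of_le_left (indep_of_indep_of_le_right this
      (le_iSup₂_of_le j rfl le_rfl)) ?_)
    rw [← measurable_iff_comap_le]
    exact @measurable_tsum_ofReal_mul Ω (⨆ k ∈ {k : ℕ | k ≠ j}, MeasurableSpace.comap (F n k)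
      inferInstance) (F n) _ fun k hk => measurable_biSup_comap (G := F n) fun h => hk (by simp [h])

/-- Given the locations, the sectors fail to be detected independently. -/
lemma measure_forall_not_success [MeasurableSpace Ω] {P : Measure Ω} [IsProbabilityMeasure P]
    (hC : 0 < C) (hα : 0 < α) (hΓ : 0 < Γ) {M : ℕ} (hx : ∀ i, IsRegular x (sector M i))
    (hF : ∀ n k, Measurable (F n k)) (hl : ∀ n k, HasLaw (F n k) (expMeasure 1) P)
    (hi : iIndepFun (fun p : ℕ × ℕ => F p.1 p.2) P) (N : ℕ) :
    P {ω | ∀ n, 1 ≤ n → n ≤ N → ¬ Success C α Γ (fun k _ => x k) F M n ω} =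
      ∏ i : Fin M, (1 - (expE (logLoss α Γ (sector M i) x))⁻¹) ^ N := by
  classical
  -- The fading variables that decide one sector in one cycle; these index sets are disjoint because
  -- the sectors are.
  set A : ℕ × Fin M → Set (ℕ × ℕ) := fun q => {p | p.1 = q.1 ∧ x p.2 ∈ sector M q.2} with hA
  have hAd : Pairwise (fun i j => Disjoint (A i) (A j)) := by
    intro q r hqr
    rw [Set.disjoint_left]
    rintro p ⟨h1, h2⟩ ⟨h3, h4⟩
    have h5 : q.2 ≠ r.2 := fun h => hqr (Prod.ext (h1.symm.trans h3) h)
    exact Set.disjoint_left.1 (disjoint_sector h5) h2 h4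
  set D : ℕ × Fin M → Set Ω :=
    fun q => {ω | SectorDetected C α Γ (fun k _ => x k) F (sector M q.2) q.1 ω} with hD
  have hDm : ∀ q, MeasurableSet[⨆ p ∈ A q, MeasurableSpace.comap (F p.1 p.2) inferInstance]
      (D q) := fun q => by
    refine @measurableSet_sectorDetected Ω C α Γ x F (sector M q.2)
      (⨆ p ∈ A q, MeasurableSpace.comap (F p.1 p.2) inferInstance) hC hα (hx q.2).existsUnique q.1
      (fun k hk => ?_)
    exact measurable_biSup_comap (G := fun p : ℕ × ℕ => F p.1 p.2) (a := (q.1, k)) ⟨rfl, hk⟩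
  have hDm' : ∀ q, MeasurableSet (D q) := fun q => by
    have hle : (⨆ p ∈ A q, MeasurableSpace.comap (F p.1 p.2) inferInstance) ≤
        (inferInstance : MeasurableSpace Ω) := iSup₂_le fun p _ => (hF p.1 p.2).comap_le
    exact hle (D q) (hDm q)
  have key := lintegral_finsetProd_of_iIndep (P := P) (fun p : ℕ × ℕ => (hF p.1 p.2).comap_le) hi
    hAd (f := fun q => (D q)ᶜ.indicator 1) (fun q => @measurable_indicator_compl_one Ω
      (⨆ p ∈ A q, MeasurableSpace.comap (F p.1 p.2) inferInstance) _ (hDm q))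
    (Finset.Icc 1 N ×ˢ Finset.univ)
  have hP : ∀ q, ∫⁻ ω, (D q)ᶜ.indicator 1 ω ∂P =
      1 - (expE (logLoss α Γ (sector M q.2) x))⁻¹ := fun q => by
    rw [lintegral_indicator_one (hDm' q).compl, prob_compl_eq_one_sub (hDm' q), hD]
    simp only []
    rw [measure_sectorDetected hC hα hΓ (hx q.2) (hF q.1) (hl q.1)
      (hi.precomp (g := fun k => (q.1, k)) fun a b h => (Prod.mk.inj h).2)]
  have hset : ∀ ω, ∏ q ∈ Finset.Icc 1 N ×ˢ Finset.univ, (D q)ᶜ.indicator (1 : Ω → ℝ≥0∞) ω =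
      {ω | ∀ n, 1 ≤ n → n ≤ N → ¬ Success C α Γ (fun k _ => x k) F M n ω}.indicator 1 ω :=
      fun ω => by
    by_cases h : ω ∈ {ω | ∀ n, 1 ≤ n → n ≤ N → ¬ Success C α Γ (fun k _ => x k) F M n ω}
    · rw [Set.indicator_of_mem h]
      refine Finset.prod_eq_one fun q hq => Set.indicator_of_mem ?_ _
      rw [Finset.mem_product, Finset.mem_Icc] at hq
      exact fun hd => h q.1 hq.1.1 hq.1.2 ⟨q.2, hd⟩
    · rw [Set.indicator_of_notMem h]
      have h' : ∃ n, 1 ≤ n ∧ n ≤ N ∧ Success C α Γ (fun k _ => x k) F M n ω := by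
        by_contra hc
        exact h fun n h1 h2 h3 => hc ⟨n, h1, h2, h3⟩
      obtain ⟨n, h1, h2, i, hs⟩ := h'
      refine Finset.prod_eq_zero (i := (n, i)) (by simp [h1, h2]) (Set.indicator_of_notMem ?_ _)
      exact fun hc => hc hs
  have hmE : MeasurableSet {ω | ∀ n, 1 ≤ n → n ≤ N → ¬ Success C α Γ (fun k _ => x k) F M n ω} := by
    simp only [Success, not_exists, Set.ofPred_forall]
    exact MeasurableSet.iInter fun n => .iInter fun _ => .iInter fun _ => .iInter fun i =>
      (hDm' (n, i)).compl
  rw [lintegral_congr hset, lintegral_indicator_one hmE] at key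
  rw [key, Finset.prod_congr rfl fun q _ => hP q, Finset.prod_product_right]
  simp

end

/-! ### Discretisation of the loss by annular cells -/

/-- The index of the annulus around the origin that contains `z`. -/
def annulusIdx (c : ℝ) (z : ℂ) : ℕ := ⌊c * ‖z‖ ^ 2⌋₊

/-- The part of `S` in the annulus `m ≤ c ‖z‖ ^ 2 < m + 1`. -/
def cell (c : ℝ) (S : Set ℂ) (m : ℕ) : Set ℂ := {z | z ∈ S ∧ annulusIdx c z = m}

/-- The event that `k` is the first nonempty cell. -/
def IsFirst (ν : ℕ → ℕ∞) (k : ℕ) : Prop := ν k ≠ 0 ∧ ∀ m < k, ν m = 0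

open Classical in
/-- The lower approximation of `logLoss` that only uses the numbers of points in the cells. -/
def cellLoss (α Γ : ℝ) (ν : ℕ → ℕ∞) : ℝ≥0∞ :=
  ∑' k, if IsFirst ν k then
    ∑' m, (if k < m then ENNReal.ofReal (Real.log (1 + Γ * ((k : ℝ) / (m + 1)) ^ (α / 2)))
      else 0) * (ν m : ℝ≥0∞) else 0

lemma annulusIdx_mono {c : ℝ} (hc : 0 < c) {z w : ℂ} (h : ‖z‖ ≤ ‖w‖) :
    annulusIdx c z ≤ annulusIdx c w := by
  unfold annulusIdx; gcongr

lemma IsFirst.unique {ν : ℕ → ℕ∞} {k l : ℕ} (hk : IsFirst ν k) (hl : IsFirst ν l) : k = l := by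
  rcases lt_trichotomy k l with h | h | h
  · exact absurd (hl.2 k h) hk.1
  · exact h
  · exact absurd (hk.2 l h) hl.1

lemma cellLoss_eq {α Γ : ℝ} {ν : ℕ → ℕ∞} {k : ℕ} (hk : IsFirst ν k) :
    cellLoss α Γ ν = ∑' m, (if k < m then
      ENNReal.ofReal (Real.log (1 + Γ * ((k : ℝ) / (m + 1)) ^ (α / 2))) else 0) * (ν m : ℝ≥0∞) := by
  classical
  rw [cellLoss, tsum_eq_single k, if_pos hk]
  · intro l hl
    rw [if_neg fun h => hl (h.unique hk)]

lemma measurableSet_isFirst (k : ℕ) : MeasurableSet {ν : ℕ → ℕ∞ | IsFirst ν k} := by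
  have h : ∀ m, MeasurableSet {ν : ℕ → ℕ∞ | ν m = 0} := fun m =>
    measurable_pi_apply m (measurableSet_singleton 0)
  have : {ν : ℕ → ℕ∞ | IsFirst ν k} =
      {ν : ℕ → ℕ∞ | ν k = 0}ᶜ ∩ ⋂ m, ⋂ (_ : m < k), {ν : ℕ → ℕ∞ | ν m = 0} := by
    ext ν; simp [IsFirst]
  rw [this]
  exact (h k).compl.inter (MeasurableSet.iInter fun m => MeasurableSet.iInter fun _ => h m)

lemma measurable_cellLoss (α Γ : ℝ) : Measurable (cellLoss α Γ) := by
  classical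
  refine Measurable.tsum fun k => Measurable.ite (measurableSet_isFirst k) ?_ measurable_const
  refine Measurable.tsum fun m => ?_
  exact ((measurable_from_top (f := fun n : ℕ∞ => (n : ℝ≥0∞))).comp
    (measurable_pi_apply m)).const_mul _

section
variable {x : ℕ → ℂ} {S : Set ℂ} {c : ℝ}

/-- The number of points in the cells. -/
def cellCount (x : ℕ → ℂ) (c : ℝ) (S : Set ℂ) (m : ℕ) : ℕ∞ := {j | x j ∈ cell c S m}.encard

-- Interchanging the two sums converts cell counts into a sum over points.
open Classical in
lemma tsum_mul_cellCount (w : ℕ → ℝ≥0∞) :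
    ∑' m, w m * (cellCount x c S m : ℝ≥0∞) =
      ∑' j, if x j ∈ S then w (annulusIdx c (x j)) else 0 := by
  have h : ∀ m, w m * (cellCount x c S m : ℝ≥0∞) =
      ∑' j, if x j ∈ cell c S m then w m else 0 := fun m => by
    rw [cellCount, mul_comm, ← tsum_ite_eq_encard_mul]; rfl
  simp_rw [h]
  rw [ENNReal.tsum_comm]
  refine tsum_congr fun j => ?_
  by_cases hj : x j ∈ S
  · rw [tsum_eq_single (annulusIdx c (x j))]
    · simp [cell, hj]
    · intro m hm
      exact if_neg fun h => hm h.2.symm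
  · simp [cell, hj]

lemma isFirst_cellCount (hc : 0 < c) {j : ℕ} (hj : IsNearest x S j) :
    IsFirst (cellCount x c S) (annulusIdx c (x j)) := by
  constructor
  · rw [cellCount, Set.encard_ne_zero]
    exact ⟨j, hj.1, rfl⟩
  · intro m hm
    rw [cellCount, Set.encard_eq_zero, Set.eq_empty_iff_forall_notMem]
    rintro k ⟨hk, rfl⟩
    exact absurd (annulusIdx_mono hc (hj.2 k hk)) (not_le.2 hm)

open Classical in
lemma cellLoss_cellCount {α Γ : ℝ} (hc : 0 < c) {j : ℕ} (hj : IsNearest x S j) :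
    cellLoss α Γ (cellCount x c S) = ∑' k, if x k ∈ S then
      (if annulusIdx c (x j) < annulusIdx c (x k) then ENNReal.ofReal (Real.log (1 +
        Γ * ((annulusIdx c (x j) : ℝ) / (annulusIdx c (x k) + 1)) ^ (α / 2))) else 0) else 0 := by
  rw [cellLoss_eq (isFirst_cellCount hc hj)]
  exact tsum_mul_cellCount (fun m => if annulusIdx c (x j) < m then
      ENNReal.ofReal (Real.log (1 + Γ * ((annulusIdx c (x j) : ℝ) / (m + 1)) ^ (α / 2))) else 0)

lemma log_loss_mono {Γ a b β : ℝ} (hΓ : 0 ≤ Γ) (hβ : 0 ≤ β) (ha : 0 ≤ a) (hab : a ≤ b) :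
    ENNReal.ofReal (Real.log (1 + Γ * a ^ β)) ≤ ENNReal.ofReal (Real.log (1 + Γ * b ^ β)) := by
  refine ENNReal.ofReal_le_ofReal (Real.log_le_log (by positivity) ?_)
  gcongr

lemma sq_rpow_half {a α : ℝ} (ha : 0 ≤ a) : (a ^ 2) ^ (α / 2) = a ^ α := by
  rw [← Real.rpow_natCast a 2, ← Real.rpow_mul ha]
  congr 1; push_cast; ring

/-- The squared distance of the nearest point is rounded down, those of the others are rounded up,
and points sharing the first cell are dropped. Every change lowers the sum. -/
lemma cellLoss_le_logLoss {α Γ : ℝ} (hα : 0 ≤ α) (hΓ : 0 ≤ Γ) (hc : 0 < c) (hx : IsRegular x S) :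
    cellLoss α Γ (cellCount x c S) ≤ logLoss α Γ S x := by
  classical
  obtain ⟨j, hj, -⟩ := hx.existsUnique
  rw [cellLoss_cellCount hc hj, logLoss_eq hx.existsUnique hj]
  refine ENNReal.tsum_le_tsum fun k => ?_
  by_cases hk : x k ∈ S
  · rw [if_pos hk]
    split_ifs with h1 h2
    · rw [← sq_rpow_half (a := ‖x j‖ / ‖x k‖) (by positivity)]
      refine log_loss_mono hΓ (by positivity) (by positivity) ?_
      have hk0 : 0 < ‖x k‖ := norm_pos_iff.2 (hx.ne_zero k)
      have e : (‖x j‖ / ‖x k‖) ^ 2 = (c * ‖x j‖ ^ 2) / (c * ‖x k‖ ^ 2) := by field_simp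
      rw [e]
      have h3 : (annulusIdx c (x j) : ℝ) ≤ c * ‖x j‖ ^ 2 := Nat.floor_le (by positivity)
      have h4 : c * ‖x k‖ ^ 2 ≤ annulusIdx c (x k) + 1 := (Nat.lt_floor_add_one _).le
      gcongr
    · exact absurd ⟨fun h => by rw [h] at h1; exact lt_irrefl _ h1, hk⟩ h2
    all_goals exact zero_le
  · simp [hk]

lemma tendsto_annulusIdx_div (hc : 0 < c) (z : ℂ) :
    Tendsto (fun q : ℕ => (annulusIdx (c * (q + 1)) z : ℝ) / (q + 1)) atTop (𝓝 (c * ‖z‖ ^ 2)) := by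
  have h1 := tendsto_nat_floor_mul_div_atTop (R := ℝ) (a := c * ‖z‖ ^ 2) (by positivity)
  have h2 : Tendsto (fun q : ℕ => (q : ℝ) + 1) atTop atTop :=
    tendsto_atTop_add_const_right _ _ tendsto_natCast_atTop_atTop
  refine (h1.comp h2).congr fun q => ?_
  simp only [Function.comp, annulusIdx]
  rw [show c * (q + 1) * ‖z‖ ^ 2 = c * ‖z‖ ^ 2 * ((q : ℝ) + 1) by ring]

lemma tendsto_annulusIdx_ratio (hc : 0 < c) (z w : ℂ) (hw : w ≠ 0) :
    Tendsto (fun q : ℕ => (annulusIdx (c * (q + 1)) z : ℝ) / (annulusIdx (c * (q + 1)) w + 1)) atTop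
      (𝓝 ((‖z‖ / ‖w‖) ^ 2)) := by
  have hw' : 0 < ‖w‖ := norm_pos_iff.2 hw
  have h1 := tendsto_annulusIdx_div hc z
  have h2 := (tendsto_annulusIdx_div hc w).add (tendsto_one_div_add_atTop_nhds_zero_nat (𝕜 := ℝ))
  rw [add_zero] at h2
  have h3 := h1.div h2 (by positivity)
  have e : (‖z‖ / ‖w‖) ^ 2 = (c * ‖z‖ ^ 2) / (c * ‖w‖ ^ 2) := by field_simp
  rw [e]
  refine h3.congr fun q => ?_
  have : (0 : ℝ) < q + 1 := by positivity
  simp only [Pi.div_apply]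
  field_simp

/-- Fatou's lemma for series, with the limit as an upper bound. The approximations need not be
monotone in `q`, since successive cell partitions are not nested. -/
lemma tendsto_tsum_of_le_of_tendsto {ι : Type*} {f : ℕ → ι → ℝ≥0∞} {g : ι → ℝ≥0∞}
    (hle : ∀ q, ∑' i, f q i ≤ ∑' i, g i) (h : ∀ i, Tendsto (fun q => f q i) atTop (𝓝 (g i))) :
    Tendsto (fun q => ∑' i, f q i) atTop (𝓝 (∑' i, g i)) := by
  refine tendsto_order.2 ⟨fun a ha => ?_, fun a ha => .of_forall fun q => (hle q).trans_lt ha⟩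
  rw [ENNReal.tsum_eq_iSup_sum] at ha
  obtain ⟨s, hs⟩ := lt_iSup_iff.1 ha
  have := tendsto_finsetSum s fun i _ => h i
  filter_upwards [this.eventually_const_lt hs] with q hq
  exact hq.trans_le (ENNReal.sum_le_tsum s)

/-- Termwise convergence suffices. Once the cells are fine, any other point lies in a strictly later
cell than the nearest one, and the floors have the right ratio in the limit. -/
lemma tendsto_cellLoss {α Γ : ℝ} (hα : 0 < α) (hΓ : 0 < Γ) (hc : 0 < c) (hx : IsRegular x S) :
    Tendsto (fun q : ℕ => cellLoss α Γ (cellCount x (c * (q + 1)) S)) atTop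
      (𝓝 (logLoss α Γ S x)) := by
  classical
  obtain ⟨j, hj, -⟩ := id hx.existsUnique
  have hcq : ∀ q : ℕ, 0 < c * ((q : ℝ) + 1) := fun q => by positivity
  have hle := fun q : ℕ => cellLoss_le_logLoss hα.le hΓ.le (hcq q) hx
  simp_rw [cellLoss_cellCount (hcq _) hj] at hle ⊢
  rw [logLoss_eq hx.existsUnique hj] at hle ⊢
  refine tendsto_tsum_of_le_of_tendsto hle fun k => ?_
  by_cases hk : x k ∈ S
  swap
  · simp [hk]
  simp only [if_pos hk]
  by_cases hkj : k = j
  · subst hkj; simp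
  rw [if_pos ⟨hkj, hk⟩]
  -- A tie would produce a second nearest point.
  have hlt : ‖x j‖ < ‖x k‖ := by
    refine lt_of_le_of_ne (hj.2 k hk) fun he => hkj ?_
    exact hx.existsUnique.unique ⟨hk, fun l hl => he ▸ hj.2 l hl⟩ hj
  have hk0 : 0 < ‖x k‖ := norm_pos_iff.2 (hx.ne_zero k)
  have hlt2 : c * ‖x j‖ ^ 2 < c * ‖x k‖ ^ 2 := by gcongr
  have hev : ∀ᶠ q : ℕ in atTop,
      annulusIdx (c * (q + 1)) (x j) < annulusIdx (c * (q + 1)) (x k) := by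
    filter_upwards [(tendsto_annulusIdx_div hc (x j)).eventually_lt
      (tendsto_annulusIdx_div hc (x k)) hlt2] with q hq
    have h0 : (0 : ℝ) < q + 1 := by positivity
    exact_mod_cast (div_lt_div_iff_of_pos_right h0).1 hq
  have h1 := tendsto_annulusIdx_ratio hc (x j) (x k) (hx.ne_zero k)
  have h2 : Tendsto (fun q : ℕ => Real.log (1 + Γ * ((annulusIdx (c * (q + 1)) (x j) : ℝ) /
      (annulusIdx (c * (q + 1)) (x k) + 1)) ^ (α / 2))) atTop
      (𝓝 (Real.log (1 + Γ * (‖x j‖ / ‖x k‖) ^ α))) := by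
    rw [← sq_rpow_half (α := α) (by positivity : 0 ≤ ‖x j‖ / ‖x k‖)]
    refine Tendsto.log ?_ (by positivity)
    exact ((h1.rpow_const (Or.inr (by positivity))).const_mul Γ).const_add 1
  refine ((ENNReal.continuous_ofReal.tendsto _).comp h2).congr' ?_
  filter_upwards [hev] with q hq
  rw [if_pos hq]; rfl

/-- An upper bound of `logLoss` that only uses the numbers of points in the cells. -/
lemma logLoss_le_tsum_cellCount {α Γ : ℝ} (hα : 0 ≤ α) (hΓ : 0 ≤ Γ) (hc : 0 < c)
    (hx : IsRegular x S) {k : ℕ} (hk : IsFirst (cellCount x c S) k) :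
    logLoss α Γ S x ≤ ∑' m, (if k ≤ m then ENNReal.ofReal
      (Real.log (1 + Γ * (((k : ℝ) + 1) / max (m : ℝ) (k + 1)) ^ (α / 2))) else 0) *
        (cellCount x c S m : ℝ≥0∞) := by
  classical
  obtain ⟨j, hj, -⟩ := id hx.existsUnique
  obtain rfl : annulusIdx c (x j) = k := (isFirst_cellCount hc hj).unique hk
  rw [tsum_mul_cellCount (fun m => if annulusIdx c (x j) ≤ m then ENNReal.ofReal
      (Real.log (1 + Γ * (((annulusIdx c (x j) : ℝ) + 1) / max (m : ℝ) (annulusIdx c (x j) + 1)) ^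
        (α / 2))) else 0), logLoss_eq hx.existsUnique hj]
  refine ENNReal.tsum_le_tsum fun k => ?_
  split_ifs with h1 h2 h3 h4 h5
  · rw [← sq_rpow_half (by positivity)]
    refine log_loss_mono hΓ (by positivity) (by positivity) ?_
    have hk0 : 0 < ‖x k‖ := norm_pos_iff.2 (hx.ne_zero k)
    have e : (‖x j‖ / ‖x k‖) ^ 2 = (c * ‖x j‖ ^ 2) / (c * ‖x k‖ ^ 2) := by field_simp
    have h3 : c * ‖x j‖ ^ 2 ≤ annulusIdx c (x j) + 1 := (Nat.lt_floor_add_one _).le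
    have h4 : (annulusIdx c (x k) : ℝ) ≤ c * ‖x k‖ ^ 2 := Nat.floor_le (by positivity)
    -- For a point in the first occupied cell or the next one, rounding alone gives nothing better
    -- than ratio `1`, which minimality provides; this is the role of the `max`.
    rcases le_total (annulusIdx c (x k) : ℝ) (annulusIdx c (x j) + 1) with h | h
    · rw [max_eq_right h, div_self (by positivity)]
      have := hj.2 k h1.2
      rw [div_pow]
      refine div_le_one_of_le₀ (by gcongr) (by positivity)
    · rw [max_eq_left h, e]
      have : (0 : ℝ) < annulusIdx c (x k) := lt_of_lt_of_le (by positivity) h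
      gcongr
  · exact absurd (annulusIdx_mono hc (hj.2 k h1.2)) h3
  · exact absurd h1.2 h2
  all_goals exact zero_le

end

/-! ### Poisson counts in the cells and almost sure regularity -/

/-- The Poisson distribution of mean `h` as a measure on `ℕ∞`. -/
def poissonENat (h : ℝ) : Measure ℕ∞ := (poissonMeasure h.toNNReal).map (fun n : ℕ => (n : ℕ∞))

instance (h : ℝ) : IsProbabilityMeasure (poissonENat h) :=
  Measure.isProbabilityMeasure_map measurable_from_top.aemeasurable

lemma lintegral_poissonENat (h : ℝ) (f : ℕ∞ → ℝ≥0∞) :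
    ∫⁻ n, f n ∂(poissonENat h) = ∫⁻ n : ℕ, f n ∂(poissonMeasure h.toNNReal) :=
  lintegral_map measurable_from_top measurable_from_top

lemma poissonENat_apply (h : ℝ) (s : Set ℕ∞) :
    poissonENat h s = poissonMeasure h.toNNReal {n : ℕ | (n : ℕ∞) ∈ s} :=
  Measure.map_apply measurable_from_top trivial

lemma poissonENat_singleton_zero {h : ℝ} (hh : 0 ≤ h) :
    poissonENat h {0} = ENNReal.ofReal (Real.exp (-h)) := by
  rw [poissonENat_apply]
  have : {n : ℕ | (n : ℕ∞) ∈ ({0} : Set ℕ∞)} = {0} := by ext; simp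
  rw [this, poissonMeasure_singleton_zero, Real.coe_toNNReal _ hh]

lemma poissonENat_ne_zero {h : ℝ} (hh : 0 ≤ h) :
    poissonENat h {n | n ≠ 0} = ENNReal.ofReal (1 - Real.exp (-h)) := by
  have : {n : ℕ∞ | n ≠ 0} = {0}ᶜ := by ext; simp
  rw [this, prob_compl_eq_one_sub (measurableSet_singleton 0), poissonENat_singleton_zero hh,
    ← ENNReal.ofReal_one, ENNReal.ofReal_sub _ (Real.exp_pos _).le]

lemma poissonENat_singleton_top (h : ℝ) : poissonENat h {⊤} = 0 := by
  rw [poissonENat_apply]; simp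

/-- From `e^{-h} ≥ 1 - h`: `1 - (1 + h) e^{-h} ≤ h ^ 2`. The quadratic order lets a union bound over
about `1 / h` cells vanish. -/
lemma poissonENat_two_le {h : ℝ} (hh : 0 ≤ h) :
    poissonENat h {n | 2 ≤ n} ≤ ENNReal.ofReal (h ^ 2) := by
  rw [poissonENat_apply]
  have e : {n : ℕ | (n : ℕ∞) ∈ {n : ℕ∞ | 2 ≤ n}} = ((Finset.range 2 : Finset ℕ) : Set ℕ)ᶜ := by
    ext n
    simp only [Set.mem_ofPred_eq, Set.mem_compl_iff, Finset.coe_range, Set.mem_Iio, not_lt]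
    exact_mod_cast Iff.rfl
  rw [e, prob_compl_eq_one_sub (Finset.measurableSet _), ← sum_measure_singleton,
    Finset.sum_range_succ, Finset.sum_range_one, poissonMeasure_singleton, poissonMeasure_singleton,
    Real.coe_toNNReal _ hh, ← ENNReal.ofReal_add (by positivity) (by positivity),
    ← ENNReal.ofReal_one, ← ENNReal.ofReal_sub _ (by positivity)]
  refine ENNReal.ofReal_le_ofReal ?_
  have := Real.add_one_le_exp (-h)
  simp only [pow_zero, Nat.factorial, pow_one]
  norm_num
  nlinarith [mul_le_mul_of_nonneg_left this (by linarith : 0 ≤ 1 + h)]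

lemma lintegral_expE_mul_poissonENat {h t : ℝ} (hh : 0 ≤ h) (ht : 0 ≤ t) :
    ∫⁻ n, expE (ENNReal.ofReal t * n) ∂(poissonENat h) =
      ENNReal.ofReal (Real.exp (h * (Real.exp t - 1))) := by
  rw [lintegral_poissonENat]
  simp only [ENat.toENNReal_coe, expE_mul_natCast, expE_ofReal ht]
  rw [lintegral_pow_poissonMeasure _ (Real.exp_pos t).le, Real.coe_toNNReal _ hh]

lemma lintegral_inv_expE_mul_poissonENat {h t : ℝ} (hh : 0 ≤ h) (ht : 0 ≤ t) :
    ∫⁻ n, (expE (ENNReal.ofReal t * n))⁻¹ ∂(poissonENat h) =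
      ENNReal.ofReal (Real.exp (h * (Real.exp (-t) - 1))) := by
  rw [lintegral_poissonENat]
  simp only [ENat.toENNReal_coe, expE_mul_natCast, expE_ofReal ht, ENNReal.inv_pow,
    ← ENNReal.ofReal_inv_of_pos (Real.exp_pos _), ← Real.exp_neg]
  rw [lintegral_pow_poissonMeasure _ (Real.exp_pos _).le, Real.coe_toNNReal _ hh]

lemma measurable_annulusIdx (c : ℝ) : Measurable (annulusIdx c) :=
  Nat.measurable_floor.comp ((measurable_norm.pow_const 2).const_mul c)

lemma measurableSet_cell {c : ℝ} {S : Set ℂ} (hS : MeasurableSet S) (m : ℕ) :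
    MeasurableSet (cell c S m) :=
  hS.inter (measurable_annulusIdx c (measurableSet_singleton m))

lemma cell_eq {c : ℝ} (hc : 0 < c) (S : Set ℂ) (m : ℕ) :
    cell c S m = S ∩ {z : ℂ | m / c ≤ ‖z‖ ^ 2 ∧ ‖z‖ ^ 2 < (m + 1) / c} := by
  ext z
  simp only [cell, annulusIdx, Set.mem_ofPred_eq, Set.mem_inter_iff]
  rw [Nat.floor_eq_iff (by positivity), div_le_iff₀ hc, lt_div_iff₀ hc, mul_comm c]

lemma isBounded_cell {c : ℝ} (hc : 0 < c) (S : Set ℂ) (m : ℕ) :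
    Bornology.IsBounded (cell c S m) := by
  rw [cell_eq hc]
  refine (Metric.isBounded_closedBall (x := (0 : ℂ)) (r := Real.sqrt ((m + 1) / c))).subset ?_
  rintro z ⟨-, -, hz⟩
  rw [mem_closedBall_zero_iff]
  exact Real.le_sqrt_of_sq_le hz.le

lemma volume_cell {c : ℝ} (hc : 0 < c) {M : ℕ} (hM : 1 ≤ M) (i : Fin M) (m : ℕ) :
    volume (cell c (sector M i) m) = ENNReal.ofReal (Real.pi / (M * c)) := by
  rw [cell_eq hc, volume_sector_inter_annulus hM i (by positivity) (by gcongr; linarith)]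
  congr 1
  have : (0 : ℝ) < M := by exact_mod_cast hM
  field_simp
  ring

section
variable {Ω : Type*} [MeasurableSpace Ω] {P : Measure Ω} {lam : ℝ} {X : ℕ → Ω → ℂ}

lemma IsPoissonProcess.measurable_count (hX : IsPoissonProcess P lam X) {B : Set ℂ}
    (hB : MeasurableSet B) : Measurable (count X B) := by
  refine measurable_encard.comp (measurable_set_iff.2 fun j => ?_)
  exact measurableSet_setOfPred.1 (hX.measurable j hB)

/-- The scale `c` absorbs `lam`, `π` and `M`: the mean count depends only on the refinement `q`.
This makes all sectors, for all `M`, statistically alike. -/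
lemma IsPoissonProcess.hasLaw_cell (hX : IsPoissonProcess P lam X) (hlam : 0 < lam) {M : ℕ}
    (hM : 1 ≤ M) (q : ℕ) (i : Fin M) (m : ℕ) :
    HasLaw (count X (cell (lam * Real.pi / M * (q + 1)) (sector M i) m))
      (poissonENat (1 / (q + 1))) P := by
  have hM' : (0 : ℝ) < M := by exact_mod_cast hM
  have hpi := Real.pi_pos
  have hc : 0 < lam * Real.pi / M * (q + 1) := by positivity
  have h := hX.poisson _ (measurableSet_cell (measurableSet_sector M i) m)
    (isBounded_cell hc (sector M i) m)
  have e : lam * volume.real (cell (lam * Real.pi / M * (q + 1)) (sector M i) m) = 1 / (q + 1) := by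
    rw [Measure.real, volume_cell hc hM, ENNReal.toReal_ofReal (by positivity)]
    field_simp
  rw [e] at h
  exact h

lemma IsPoissonProcess.iIndepFun_cells (hX : IsPoissonProcess P lam X) {c : ℝ} (hc : 0 < c)
    (M : ℕ) : iIndepFun (fun p : Fin M × ℕ => count X (cell c (sector M p.1) p.2)) P := by
  rw [iIndepFun_iff_finset]
  intro s
  have h := hX.indep s.card (fun k => cell c (sector M (s.equivFin.symm k).1.1)
    (s.equivFin.symm k).1.2) (fun k => measurableSet_cell (measurableSet_sector M _) _)
    (fun k => isBounded_cell hc _ _) ?_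
  · exact iIndepFun.of_precomp (g := s.equivFin.symm) s.equivFin.symm.surjective h
  · intro k l hkl
    have hne : (s.equivFin.symm k).1 ≠ (s.equivFin.symm l).1 := fun h =>
      hkl (s.equivFin.symm.injective (Subtype.ext h))
    rw [Set.disjoint_left]
    rintro z ⟨h1, h2⟩ ⟨h3, h4⟩
    by_cases h5 : (s.equivFin.symm k).1.1 = (s.equivFin.symm l).1.1
    · exact hne (Prod.ext h5 (h2.symm.trans h4))
    · exact Set.disjoint_left.1 (disjoint_sector h5) h1 h3

lemma IsPoissonProcess.lintegral_cells (hX : IsPoissonProcess P lam X) (hlam : 0 < lam) {M : ℕ}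
    (hM : 1 ≤ M) (q : ℕ) (i : Fin M) {G : (ℕ → ℕ∞) → ℝ≥0∞} (hG : Measurable G) :
    ∫⁻ ω, G (cellCount (fun j => X j ω) (lam * Real.pi / M * (q + 1)) (sector M i)) ∂P =
      ∫⁻ ν, G ν ∂(Measure.infinitePi fun _ : ℕ => poissonENat (1 / (q + 1))) := by
  have hM' : (0 : ℝ) < M := by exact_mod_cast hM
  have hpi := Real.pi_pos
  have hc : 0 < lam * Real.pi / M * (q + 1) := by positivity
  have h := ((hX.iIndepFun_cells hc M).precomp (g := fun m : ℕ => (i, m))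
    fun a b h => (Prod.mk.inj h).2).hasLaw_infinitePi (μ := fun _ => poissonENat (1 / (q + 1)))
    (fun m => hX.hasLaw_cell hlam hM q i m)
    (measurable_pi_lambda _ fun m =>
      hX.measurable_count (measurableSet_cell (measurableSet_sector M i) m)).aemeasurable
  exact h.lintegral_comp hG.aemeasurable

lemma measurable_comp_pi {G : (ℕ → ℕ∞) → ℝ≥0∞} (hG : Measurable G) {N : ℕ → Ω → ℕ∞}
    (hN : ∀ m, Measurable (N m)) : Measurable fun ω => G fun m => N m ω :=
  hG.comp (measurable_pi_lambda _ hN)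

lemma IsPoissonProcess.lintegral_prod_cells [IsProbabilityMeasure P] (hX : IsPoissonProcess P lam X) (hlam : 0 < lam) {M : ℕ}
    (hM : 1 ≤ M) (q : ℕ) {G : (ℕ → ℕ∞) → ℝ≥0∞} (hG : Measurable G) :
    ∫⁻ ω, ∏ i : Fin M, G (cellCount (fun j => X j ω) (lam * Real.pi / M * (q + 1)) (sector M i)) ∂P =
      (∫⁻ ν, G ν ∂(Measure.infinitePi fun _ : ℕ => poissonENat (1 / (q + 1)))) ^ M := by
  have hM' : (0 : ℝ) < M := by exact_mod_cast hM
  have hpi := Real.pi_pos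
  have hc : 0 < lam * Real.pi / M * (q + 1) := by positivity
  have hle : ∀ p : Fin M × ℕ, MeasurableSpace.comap (count X (cell (lam * Real.pi / M * (q + 1))
      (sector M p.1) p.2)) inferInstance ≤ (inferInstance : MeasurableSpace Ω) := fun p =>
    (hX.measurable_count (measurableSet_cell (measurableSet_sector M p.1) p.2)).comap_le
  have hA : Pairwise (fun i j => Disjoint {p : Fin M × ℕ | p.1 = i} {p : Fin M × ℕ | p.1 = j}) := by
    intro i j hij
    rw [Set.disjoint_left]
    rintro p rfl h
    exact hij h
  have hm : ∀ i : Fin M, Measurable[⨆ p ∈ {p : Fin M × ℕ | p.1 = i}, MeasurableSpace.comap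
      (count X (cell (lam * Real.pi / M * (q + 1)) (sector M p.1) p.2)) inferInstance]
      (fun ω => G (cellCount (fun j => X j ω) (lam * Real.pi / M * (q + 1)) (sector M i))) := by
    intro i
    refine @measurable_comp_pi Ω (⨆ p ∈ {p : Fin M × ℕ | p.1 = i}, MeasurableSpace.comap
      (count X (cell (lam * Real.pi / M * (q + 1)) (sector M p.1) p.2)) inferInstance) G hG
      (fun m => count X (cell (lam * Real.pi / M * (q + 1)) (sector M i) m)) fun m => ?_
    exact measurable_biSup_comap (G := fun p : Fin M × ℕ =>
      count X (cell (lam * Real.pi / M * (q + 1)) (sector M p.1) p.2)) (a := (i, m)) rfl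
  refine (lintegral_finsetProd_of_iIndep hle (hX.iIndepFun_cells hc M) hA hm Finset.univ).trans ?_
  rw [Finset.prod_congr rfl fun i _ => hX.lintegral_cells hlam hM q i hG]
  simp

/-- The first nonempty cell is finite, hence has a point of least norm; points of later cells are
farther away. -/
lemma exists_isNearest {x : ℕ → ℂ} {S : Set ℂ} {c : ℝ} (hc : 0 < c)
    (h1 : ∃ m, cellCount x c S m ≠ 0) (h2 : ∀ m, cellCount x c S m ≠ ⊤) :
    ∃ j, IsNearest x S j := by
  classical
  have hk := Nat.find_spec h1
  set k := Nat.find h1 with hkdef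
  have hfin : {j | x j ∈ cell c S k}.Finite := Set.encard_ne_top_iff.1 (h2 k)
  have hne : {j | x j ∈ cell c S k}.Nonempty := Set.encard_ne_zero.1 hk
  obtain ⟨j, hj, hmin⟩ := Set.exists_min_image _ (fun j => ‖x j‖) hfin hne
  refine ⟨j, hj.1, fun l hl => ?_⟩
  have hkl : k ≤ annulusIdx c (x l) := Nat.find_min' h1 (Set.encard_ne_zero.2 ⟨l, hl, rfl⟩)
  rcases hkl.eq_or_lt with h | h
  · exact hmin l ⟨hl, h.symm⟩
  · by_contra hlt
    have := annulusIdx_mono hc (not_le.1 hlt).le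
    rw [hj.2] at this
    exact absurd h (not_lt.2 this)

lemma two_le_cellCount {x : ℕ → ℂ} {S : Set ℂ} {c : ℝ} {j k : ℕ} (hj : x j ∈ S) (hk : x k ∈ S)
    (hjk : j ≠ k) (h : ‖x j‖ = ‖x k‖) : 2 ≤ cellCount x c S (annulusIdx c (x j)) := by
  rw [← Set.encard_pair hjk]
  refine Set.encard_le_encard ?_
  rintro l (rfl | rfl)
  · exact ⟨hj, rfl⟩
  · exact ⟨hk, by simp [annulusIdx, h]⟩

/-- Two points at equal distance share a cell at every refinement. Within `c ‖z‖ ^ 2 < K` there are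
`K (q + 1)` cells, each doubly occupied with probability at most `(q + 1)⁻²`; the union bound `K /
(q + 1)` tends to `0`. -/
lemma IsPoissonProcess.ae_injective_norm (hX : IsPoissonProcess P lam X) (hlam : 0 < lam) {M : ℕ}
    (hM : 1 ≤ M) (i : Fin M) : ∀ᵐ ω ∂P, ∀ j k, X j ω ∈ sector M i → X k ω ∈ sector M i →
      ‖X j ω‖ = ‖X k ω‖ → j = k := by
  have hM' : (0 : ℝ) < M := by exact_mod_cast hM
  have hpi := Real.pi_pos
  set c := lam * Real.pi / M with hcdef
  have hc : 0 < c := by positivity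
  set T : ℕ → Set Ω := fun K => {ω | ∃ j k, X j ω ∈ sector M i ∧ X k ω ∈ sector M i ∧
    ‖X j ω‖ = ‖X k ω‖ ∧ j ≠ k ∧ c * ‖X j ω‖ ^ 2 < K} with hT
  have hTK : ∀ K, P (T K) = 0 := fun K => by
    have hle : ∀ q : ℕ, P (T K) ≤ ENNReal.ofReal ((K : ℝ) * (1 / (q + 1))) := fun q => by
      have hsub : T K ⊆ ⋃ m ∈ Finset.range (K * (q + 1)),
          {ω | 2 ≤ count X (cell (c * (q + 1)) (sector M i) m) ω} := by
        rintro ω ⟨j, k, hj, hk, hn, hjk, hlt⟩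
        rw [Set.mem_iUnion₂]
        refine ⟨annulusIdx (c * (q + 1)) (X j ω), ?_,
          two_le_cellCount (x := fun j => X j ω) hj hk hjk hn⟩
        rw [Finset.mem_range, annulusIdx, Nat.floor_lt (by positivity)]
        push_cast
        have : (0 : ℝ) < q + 1 := by positivity
        nlinarith
      refine (measure_mono hsub).trans ((measure_biUnion_finset_le _ _).trans ?_)
      have : ∀ m ∈ Finset.range (K * (q + 1)),
          P {ω | 2 ≤ count X (cell (c * (q + 1)) (sector M i) m) ω} ≤
            ENNReal.ofReal ((1 / ((q : ℝ) + 1)) ^ 2) := fun m _ => by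
        rw [(hX.hasLaw_cell hlam hM q i m).measure_eq (p := fun n => 2 ≤ n) trivial]
        exact poissonENat_two_le (by positivity)
      refine (Finset.sum_le_sum this).trans ?_
      rw [Finset.sum_const, Finset.card_range, nsmul_eq_mul, ← ENNReal.ofReal_natCast,
        ← ENNReal.ofReal_mul (by positivity)]
      refine ENNReal.ofReal_le_ofReal (le_of_eq ?_)
      push_cast
      field_simp
    have hlim : Tendsto (fun q : ℕ => ENNReal.ofReal ((K : ℝ) * (1 / (q + 1)))) atTop (𝓝 0) := by
      have := (tendsto_one_div_add_atTop_nhds_zero_nat (𝕜 := ℝ)).const_mul (K : ℝ)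
      rw [mul_zero] at this
      simpa using ENNReal.tendsto_ofReal this
    exact le_antisymm (ge_of_tendsto' hlim hle) zero_le
  have hall : ∀ᵐ ω ∂P, ∀ K, ω ∉ T K := ae_all_iff.2 fun K => measure_eq_zero_iff_ae_notMem.1 (hTK K)
  filter_upwards [hall] with ω hω j k hj hk hn
  by_contra hjk
  obtain ⟨K, hK⟩ := exists_nat_gt (c * ‖X j ω‖ ^ 2)
  exact hω K ⟨j, k, hj, hk, hn, hjk, hK⟩

lemma IsPoissonProcess.ae_ne_zero (hX : IsPoissonProcess P lam X) : ∀ᵐ ω ∂P, ∀ j, X j ω ≠ 0 := by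
  have h := hX.poisson {0} (measurableSet_singleton 0) Bornology.isBounded_singleton
  have h0 : lam * volume.real ({0} : Set ℂ) = 0 := by simp [Measure.real]
  have h1 : P {ω | count X {0} ω ≠ 0} = 0 := by
    rw [h.measure_eq (p := fun n => n ≠ 0) trivial, h0]
    refine (poissonENat_ne_zero le_rfl).trans ?_
    simp
  have h2 : ∀ᵐ ω ∂P, count X {0} ω = 0 := h1
  filter_upwards [h2] with ω hω j hj
  rw [count, Set.encard_eq_zero] at hω
  exact Set.eq_empty_iff_forall_notMem.1 hω j hj

lemma IsPoissonProcess.ae_exists_count_ne_zero [IsProbabilityMeasure P] (hX : IsPoissonProcess P lam X) (hlam : 0 < lam)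
    {M : ℕ} (hM : 1 ≤ M) (i : Fin M) :
    ∀ᵐ ω ∂P, ∃ m, count X (cell (lam * Real.pi / M) (sector M i) m) ω ≠ 0 := by
  have hM' : (0 : ℝ) < M := by exact_mod_cast hM
  have hpi := Real.pi_pos
  have hc : 0 < lam * Real.pi / M := by positivity
  have hle : ∀ K : ℕ, P {ω | ¬ ∃ m, count X (cell (lam * Real.pi / M) (sector M i) m) ω ≠ 0} ≤
      ENNReal.ofReal (Real.exp (-1)) ^ K := fun K => by
    have hsub : {ω | ¬ ∃ m, count X (cell (lam * Real.pi / M) (sector M i) m) ω ≠ 0} ⊆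
        ⋂ m ∈ Finset.range K, count X (cell (lam * Real.pi / M) (sector M i) m) ⁻¹' {0} := by
      intro ω hω
      refine Set.mem_iInter₂.2 fun m _ => ?_
      by_contra h
      exact hω ⟨m, h⟩
    refine (measure_mono hsub).trans ?_
    have hi := (hX.iIndepFun_cells hc M).precomp (g := fun m : ℕ => (i, m))
      fun a b h => (Prod.mk.inj h).2
    have hm := hi.measure_inter_preimage_eq_mul (Finset.range K) (sets := fun _ => {0})
      (fun m _ => measurableSet_singleton 0)
    refine (le_of_eq hm).trans ?_
    refine le_of_eq ((Finset.prod_eq_pow_card fun m _ => ?_).trans (by rw [Finset.card_range]))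
    have hl := hX.hasLaw_cell hlam hM 0 i m
    simp only [CharP.cast_eq_zero, zero_add, mul_one, div_one] at hl
    refine (hl.measure_eq (p := fun n => n = 0) trivial).trans ?_
    exact poissonENat_singleton_zero zero_le_one
  have hlt : ENNReal.ofReal (Real.exp (-1)) < 1 := by
    rw [ENNReal.ofReal_lt_one]; rw [← Real.exp_zero]; exact Real.exp_lt_exp.2 (by norm_num)
  exact le_antisymm (ge_of_tendsto' (ENNReal.tendsto_pow_atTop_nhds_zero_of_lt_one hlt) hle) zero_le

lemma IsPoissonProcess.ae_isRegular [IsProbabilityMeasure P] (hX : IsPoissonProcess P lam X) (hlam : 0 < lam) {M : ℕ}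
    (hM : 1 ≤ M) (i : Fin M) : ∀ᵐ ω ∂P, IsRegular (fun j => X j ω) (sector M i) := by
  have hM' : (0 : ℝ) < M := by exact_mod_cast hM
  have hpi := Real.pi_pos
  have hc : 0 < lam * Real.pi / M := by positivity
  have hfin : ∀ᵐ ω ∂P, ∀ m, count X (cell (lam * Real.pi / M) (sector M i) m) ω ≠ ⊤ := by
    refine ae_all_iff.2 fun m => ?_
    have hl := hX.hasLaw_cell hlam hM 0 i m
    simp only [CharP.cast_eq_zero, zero_add, mul_one, div_one] at hl
    have : P {ω | count X (cell (lam * Real.pi / M) (sector M i) m) ω = ⊤} = 0 :=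
      (hl.measure_eq (p := fun n => n = ⊤) trivial).trans (poissonENat_singleton_top 1)
    exact measure_eq_zero_iff_ae_notMem.1 this
  filter_upwards [hX.ae_ne_zero, hX.ae_injective_norm hlam hM i,
    hX.ae_exists_count_ne_zero hlam hM i, hfin] with ω h1 h2 h3 h4
  obtain ⟨j, hj⟩ := exists_isNearest hc h3 h4
  refine ⟨h1, j, hj, fun k hk => h2 k j hk.1 hj.1 ?_⟩
  exact le_antisymm (hk.2 j hj.1) (hj.2 k hk.1)

end

/-! ### The mean number of cycles as a series -/

lemma lt_numCycles_iff {Ω : Type*} {X : ℕ → Ω → ℂ} {F : ℕ → ℕ → Ω → ℝ} {C α Γ : ℝ} {M N : ℕ}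
    {ω : Ω} : (N : ℕ∞) < numCycles C α Γ X F M ω ↔
    ∀ n, 1 ≤ n → n ≤ N → ¬ Success C α Γ X F M n ω := by
  rw [numCycles]
  constructor
  · intro h n h1 h2 hs
    have : sInf ((fun n : ℕ => (n : ℕ∞)) '' {n : ℕ | 1 ≤ n ∧ Success C α Γ X F M n ω}) ≤ n :=
      sInf_le ⟨n, ⟨h1, hs⟩, rfl⟩
    exact absurd (h.trans_le this) (not_lt.2 (by exact_mod_cast h2))
  · intro h
    have h1 : ((N + 1 : ℕ) : ℕ∞) ≤
        sInf ((fun n : ℕ => (n : ℕ∞)) '' {n : ℕ | 1 ≤ n ∧ Success C α Γ X F M n ω}) := by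
      refine le_sInf ?_
      rintro _ ⟨n, ⟨hn, hs⟩, rfl⟩
      have : N < n := by
        by_contra hc
        exact h n hn (not_lt.1 hc) hs
      exact Nat.cast_le.2 this
    exact lt_of_lt_of_le (by exact_mod_cast Nat.lt_succ_self N) h1

section
variable {Ω : Type*} [MeasurableSpace Ω] {X : ℕ → Ω → ℂ} {F : ℕ → ℕ → Ω → ℝ} {C α Γ : ℝ}

lemma measurableSet_sectorDetected_of_measurable (hX : ∀ j, Measurable (X j))
    (hF : ∀ n j, Measurable (F n j)) {S : Set ℂ} (hS : MeasurableSet S) (n : ℕ) :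
    MeasurableSet {ω | SectorDetected C α Γ X F S n ω} := by
  classical
  have hl : ∀ j, Measurable fun ω => pathLoss C α ‖X j ω‖ := fun j =>
    ((hX j).norm.pow_const α).const_mul C
  have hr : ∀ j, Measurable fun ω => receivedPower C α X F n j ω := fun j =>
    (hF n j).ennreal_ofReal.div (hl j).ennreal_ofReal
  have hmem : ∀ j, MeasurableSet {ω | X j ω ∈ S} := fun j => hX j hS
  have hI : ∀ j, Measurable fun ω => interference C α X F S n j ω := fun j => by
    -- With random locations the index type of the interference sum depends on `ω`; a conditional
    -- summand over all `k` removes this dependence.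
    have e : ∀ ω, interference C α X F S n j ω =
        ∑' k, if k ≠ j ∧ X k ω ∈ S then receivedPower C α X F n k ω else 0 := fun ω => by
      refine (tsum_subtype {k : ℕ | k ≠ j ∧ X k ω ∈ S}
        (fun k => receivedPower C α X F n k ω)).trans (tsum_congr fun k => ?_)
      rw [Set.indicator_apply]; rfl
    simp_rw [e]
    exact Measurable.tsum fun k => Measurable.ite
      ((MeasurableSet.const _).inter (hmem k)) (hr k) measurable_const
  have : {ω | SectorDetected C α Γ X F S n ω} = ⋃ j, {ω | X j ω ∈ S} ∩
      ((⋂ k, {ω | X k ω ∈ S}ᶜ ∪ {ω | pathLoss C α ‖X j ω‖ ≤ pathLoss C α ‖X k ω‖}) ∩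
        {ω | ENNReal.ofReal Γ < sir C α X F S n j ω}) := by
    ext ω
    simp only [SectorDetected, Set.mem_ofPred_eq, Set.mem_iUnion, Set.mem_inter_iff,
      Set.mem_iInter, Set.mem_union, Set.mem_compl_iff, imp_iff_not_or]
  rw [this]
  exact MeasurableSet.iUnion fun j => (hmem j).inter ((MeasurableSet.iInter fun k =>
    (hmem k).compl.union (measurableSet_le (hl j) (hl k))).inter
      (measurableSet_lt measurable_const ((hr j).div (hI j))))

lemma measurableSet_forall_not_success (hX : ∀ j, Measurable (X j))
    (hF : ∀ n j, Measurable (F n j)) (M N : ℕ) :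
    MeasurableSet {ω | ∀ n, 1 ≤ n → n ≤ N → ¬ Success C α Γ X F M n ω} := by
  simp only [Success, not_exists, Set.ofPred_forall]
  exact MeasurableSet.iInter fun n => .iInter fun _ => .iInter fun _ => .iInter fun i =>
    (measurableSet_sectorDetected_of_measurable hX hF (measurableSet_sector M i) n).compl

lemma meanCycles_eq_tsum {P : Measure Ω} (hX : ∀ j, Measurable (X j))
    (hF : ∀ n j, Measurable (F n j)) (M : ℕ) : meanCycles C α Γ X F P M =
      ∑' N : ℕ, P {ω | ∀ n, 1 ≤ n → n ≤ N → ¬ Success C α Γ X F M n ω} := by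
  classical
  have hm := fun N => measurableSet_forall_not_success (C := C) (α := α) (Γ := Γ) hX hF M N
  have e : ∀ ω, (numCycles C α Γ X F M ω : ℝ≥0∞) = ∑' N : ℕ,
      {ω | ∀ n, 1 ≤ n → n ≤ N → ¬ Success C α Γ X F M n ω}.indicator 1 ω := fun ω => by
    rw [coe_enat_eq_tsum]
    refine tsum_congr fun N => ?_
    by_cases h : ω ∈ {ω | ∀ n, 1 ≤ n → n ≤ N → ¬ Success C α Γ X F M n ω}
    · rw [Set.indicator_of_mem h, if_pos (lt_numCycles_iff.2 h)]; rfl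
    · rw [Set.indicator_of_notMem h, if_neg fun h' => h (lt_numCycles_iff.1 h')]
  simp_rw [meanCycles, e]
  rw [lintegral_tsum fun N => (measurable_one.indicator (hm N)).aemeasurable]
  exact tsum_congr fun N => lintegral_indicator_one (hm N)

variable {P : Measure Ω} [IsProbabilityMeasure P] {lam : ℝ}

/-- Conditioning on the locations: by independence the joint law of locations and fadings is a
product, and Fubini applies. -/
lemma measure_forall_not_success_eq_lintegral (hX : ∀ j, Measurable (X j))
    (hF : IsRayleighFading P X F) (M N : ℕ) :
    P {ω | ∀ n, 1 ≤ n → n ≤ N → ¬ Success C α Γ X F M n ω} =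
      ∫⁻ ω, P {ω' | ∀ n, 1 ≤ n → n ≤ N → ¬ Success C α Γ (fun j _ => X j ω) F M n ω'} ∂P := by
  set E : Set ((ℕ → ℂ) × (ℕ × ℕ → ℝ)) := {p | ∀ n, 1 ≤ n → n ≤ N →
    ¬ Success C α Γ (fun j (p : (ℕ → ℂ) × (ℕ × ℕ → ℝ)) => p.1 j) (fun n j p => p.2 (n, j)) M n p}
    with hE
  have hEm : MeasurableSet E := measurableSet_forall_not_success
    (fun j => (measurable_pi_apply j).comp measurable_fst)
    (fun n j => (measurable_pi_apply (n, j)).comp measurable_snd) M N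
  have hXm : Measurable fun ω (j : ℕ) => X j ω := measurable_pi_lambda _ hX
  have hFm : Measurable fun ω (p : ℕ × ℕ) => F p.1 p.2 ω :=
    measurable_pi_lambda _ fun p => hF.measurable p.1 p.2
  have h1 := (indepFun_iff_map_prod_eq_prod_map_map hXm.aemeasurable hFm.aemeasurable).1
    hF.indep_locations
  have h2 : P {ω | ∀ n, 1 ≤ n → n ≤ N → ¬ Success C α Γ X F M n ω} =
      P.map (fun ω => ((fun j => X j ω), (fun p : ℕ × ℕ => F p.1 p.2 ω))) E := by
    rw [Measure.map_apply (hXm.prodMk hFm) hEm]; rfl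
  have := Measure.isProbabilityMeasure_map (μ := P) hFm.aemeasurable
  rw [h2, h1, Measure.prod_apply hEm, lintegral_map (measurable_measure_prodMk_left hEm) hXm]
  refine lintegral_congr fun ω => ?_
  rw [Measure.map_apply hFm (measurable_prodMk_left hEm)]
  rfl

/-- The probability that a single sector stays undetected in `N` cycles. -/
def missProb (P : Measure Ω) (α Γ : ℝ) (X : ℕ → Ω → ℂ) (N : ℕ) : ℝ≥0∞ :=
  ∫⁻ ω, (1 - (expE (logLoss α Γ Set.univ fun j => X j ω))⁻¹) ^ N ∂P

/-- On the left, `M` enters only as an exponent. -/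
lemma tendsto_pow_cells (hX : IsPoissonProcess P lam X) (hlam : 0 < lam) (hα : 0 < α) (hΓ : 0 < Γ)
    {M : ℕ} (hM : 1 ≤ M) (N : ℕ) :
    Tendsto (fun q : ℕ => (∫⁻ ν, (1 - (expE (cellLoss α Γ ν))⁻¹) ^ N
        ∂(Measure.infinitePi fun _ : ℕ => poissonENat (1 / (q + 1)))) ^ M) atTop
      (𝓝 (∫⁻ ω, ∏ i : Fin M,
        (1 - (expE (logLoss α Γ (sector M i) fun j => X j ω))⁻¹) ^ N ∂P)) := by
  have hM' : (0 : ℝ) < M := by exact_mod_cast hM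
  have hpi := Real.pi_pos
  have hc : 0 < lam * Real.pi / M := by positivity
  have hG : Measurable fun ν => (1 - (expE (cellLoss α Γ ν))⁻¹) ^ N :=
    ((measurable_inv_expE.comp (measurable_cellLoss α Γ)).const_sub 1).pow_const N
  have hcont : Continuous fun t : ℝ≥0∞ => (1 - (expE t)⁻¹) ^ N :=
    (ENNReal.continuous_pow N).comp
      ((ENNReal.continuous_sub_left ENNReal.one_ne_top).comp (continuous_inv.comp continuous_expE))
  simp_rw [← hX.lintegral_prod_cells hlam hM _ hG]
  refine tendsto_lintegral_of_dominated_convergence (fun _ => 1) (fun q => ?_)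
    (fun q => ae_of_all _ fun ω => ?_) (by simp) ?_
  · refine Finset.measurable_fun_prod _ fun i _ => ?_
    exact measurable_comp_pi hG fun m =>
      hX.measurable_count (measurableSet_cell (measurableSet_sector M i) m)
  · exact Finset.prod_le_one' fun i _ => pow_le_one' tsub_le_self N
  · filter_upwards [ae_all_iff.2 fun i => hX.ae_isRegular hlam hM i] with ω hω
    exact ENNReal.tendsto_finsetProd_of_ne_top _
      (fun i _ => (hcont.tendsto _).comp (tendsto_cellLoss hα hΓ hc (hω i)))
      fun i _ => ((pow_le_one' tsub_le_self N).trans_lt ENNReal.one_lt_top).ne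

/-- Both sides are limits of the same discretised quantities, the whole plane being the single
sector for `M = 1`. This replaces the invariance of the Poisson process under rescaling of angles
and radii. -/
lemma lintegral_prod_sectors (hX : IsPoissonProcess P lam X) (hlam : 0 < lam) (hα : 0 < α)
    (hΓ : 0 < Γ) {M : ℕ} (hM : 1 ≤ M) (N : ℕ) :
    ∫⁻ ω, ∏ i : Fin M, (1 - (expE (logLoss α Γ (sector M i) fun j => X j ω))⁻¹) ^ N ∂P =
      missProb P α Γ X N ^ M := by
  have h1 := tendsto_pow_cells hX hlam hα hΓ le_rfl N
  simp only [Finset.univ_unique, Finset.prod_singleton, pow_one, sector_one] at h1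
  exact tendsto_nhds_unique (tendsto_pow_cells hX hlam hα hΓ hM N)
    (((ENNReal.continuous_pow M).tendsto _).comp h1)

/-- The mean number of cycles as a series, in which the number of beams is an exponent. -/
lemma meanCycles_eq_tsum_missProb (hX : IsPoissonProcess P lam X) (hF : IsRayleighFading P X F)
    (hlam : 0 < lam) (hC : 0 < C) (hα : 0 < α) (hΓ : 0 < Γ) {M : ℕ} (hM : 1 ≤ M) :
    meanCycles C α Γ X F P M = ∑' N : ℕ, missProb P α Γ X N ^ M := by
  rw [meanCycles_eq_tsum hX.measurable hF.measurable]
  refine tsum_congr fun N => ?_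
  rw [measure_forall_not_success_eq_lintegral hX.measurable hF,
    ← lintegral_prod_sectors hX hlam hα hΓ hM]
  refine lintegral_congr_ae ?_
  filter_upwards [ae_all_iff.2 fun i => hX.ae_isRegular hlam hM i] with ω hω
  exact measure_forall_not_success hC hα hΓ hω hF.measurable hF.law hF.iid N

lemma missProb_le_one (N : ℕ) : missProb P α Γ X N ≤ 1 := by
  refine (lintegral_mono fun ω => pow_le_one' tsub_le_self N).trans ?_
  simp

end

/-! ### Comparison of power sums with integrals -/

lemma one_add_mul_le_one_add_rpow_of_nonpos {x p : ℝ} (hx : -1 < x) (hp : p ≤ 0) :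
    1 + p * x ≤ (1 + x) ^ p := by
  have h1 : 0 < 1 + x := by linarith
  rw [Real.rpow_def_of_pos h1]
  have h2 := Real.log_le_sub_one_of_pos h1
  have h3 := Real.add_one_le_exp (Real.log (1 + x) * p)
  nlinarith

/-- Integral comparison for `y ↦ y ^ (-β)`, upper bound. -/
lemma rpow_neg_succ_le {β y : ℝ} (hβ : 1 < β) (hy : 0 < y) :
    (β - 1) * (y + 1) ^ (-β) ≤ y ^ (1 - β) - (y + 1) ^ (1 - β) := by
  have ht : 0 < y + 1 := by linarith
  have h1 := one_add_mul_le_one_add_rpow_of_nonpos (x := -1 / (y + 1)) (p := 1 - β)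
    (by rw [lt_div_iff₀ ht]; linarith) (by linarith)
  have e1 : y ^ (1 - β) = (y + 1) ^ (1 - β) * (1 + -1 / (y + 1)) ^ (1 - β) := by
    have e0 : 1 + -1 / (y + 1) = y / (y + 1) := by field_simp; ring
    rw [e0, ← Real.mul_rpow ht.le (by positivity), mul_div_cancel₀ _ ht.ne']
  have e2 : (y + 1) ^ (-β) = (y + 1) ^ (1 - β) / (y + 1) := by
    rw [show -β = (1 - β) - 1 by ring, Real.rpow_sub_one ht.ne']
  have h2 := mul_le_mul_of_nonneg_left h1 (Real.rpow_pos_of_pos ht (1 - β)).le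
  rw [← e1] at h2
  rw [e2]
  calc _ = (y + 1) ^ (1 - β) * (1 + (1 - β) * (-1 / (y + 1))) - (y + 1) ^ (1 - β) := by ring
    _ ≤ _ := by linarith

/-- Integral comparison for `y ↦ y ^ (-β)`, lower bound. -/
lemma le_rpow_neg {β y : ℝ} (hβ : 1 < β) (hy : 0 < y) :
    y ^ (1 - β) - (y + 1) ^ (1 - β) ≤ (β - 1) * y ^ (-β) := by
  have h1 := one_add_mul_le_one_add_rpow_of_nonpos (x := 1 / y) (p := 1 - β)
    (by have : 0 < 1 / y := by positivity
        linarith) (by linarith)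
  have e1 : (y + 1) ^ (1 - β) = y ^ (1 - β) * (1 + 1 / y) ^ (1 - β) := by
    rw [← Real.mul_rpow hy.le (by positivity)]
    congr 1; field_simp
  have e2 : y ^ (-β) = y ^ (1 - β) / y := by
    rw [show -β = (1 - β) - 1 by ring, Real.rpow_sub_one hy.ne']
  have h2 := mul_le_mul_of_nonneg_left h1 (Real.rpow_pos_of_pos hy (1 - β)).le
  rw [← e1] at h2
  rw [e2]
  calc _ ≤ y ^ (1 - β) - y ^ (1 - β) * (1 + (1 - β) * (1 / y)) := by linarith
    _ = _ := by ring

lemma div_rpow_eq_mul_neg {a b β : ℝ} (ha : 0 ≤ a) (hb : 0 ≤ b) :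
    (a / b) ^ β = a ^ β * b ^ (-β) := by
  rw [Real.div_rpow ha hb, Real.rpow_neg hb, div_eq_mul_inv]

/-- The bound is `∫_a^∞ (a / y) ^ β dy`; the comparison telescopes. -/
lemma sum_shift_rpow_le {β a : ℝ} (hβ : 1 < β) (ha : 0 < a) (n : ℕ) :
    ∑ i ∈ Finset.range n, (a / (a + i + 1)) ^ β ≤ a / (β - 1) := by
  have hb : 0 < β - 1 := by linarith
  have h : ∑ i ∈ Finset.range n, (β - 1) * (a + i + 1) ^ (-β) ≤ a ^ (1 - β) := by
    have : ∀ i ∈ Finset.range n, (β - 1) * (a + i + 1) ^ (-β) ≤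
        (a + i) ^ (1 - β) - (a + (i + 1 : ℕ)) ^ (1 - β) := fun i _ => by
      push_cast
      rw [← add_assoc]
      exact rpow_neg_succ_le hβ (by positivity)
    refine (Finset.sum_le_sum this).trans ?_
    rw [Finset.sum_range_sub' (fun i : ℕ => (a + i) ^ (1 - β))]
    simp only [CharP.cast_eq_zero, add_zero]
    have : 0 ≤ (a + n) ^ (1 - β) := by positivity
    linarith
  have e : ∑ i ∈ Finset.range n, (a / (a + i + 1)) ^ β =
      a ^ β / (β - 1) * ∑ i ∈ Finset.range n, (β - 1) * (a + i + 1) ^ (-β) := by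
    rw [Finset.mul_sum]
    refine Finset.sum_congr rfl fun i _ => ?_
    rw [div_rpow_eq_mul_neg ha.le (by positivity)]
    field_simp
  rw [e]
  refine (mul_le_mul_of_nonneg_left h (by positivity)).trans (le_of_eq ?_)
  rw [div_mul_eq_mul_div, ← Real.rpow_add ha]
  simp

/-- Starting at `a + 2` instead of `a` costs at most `2`, truncation at `n` at most `1`. It matters
that the error `3` is independent of `a`: this settles the critical case of the phase transition. -/
lemma exists_le_sum_shift_rpow {β a : ℝ} (hβ : 1 < β) (ha : 0 < a) :
    ∃ n : ℕ, a / (β - 1) - 3 ≤ ∑ i ∈ Finset.range n, (a / (a + 2 + i)) ^ β := by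
  have hb : 0 < β - 1 := by linarith
  have e : ∀ n : ℕ, ∑ i ∈ Finset.range n, (a / (a + 2 + i)) ^ β =
      a ^ β / (β - 1) * ∑ i ∈ Finset.range n, (β - 1) * (a + 2 + i) ^ (-β) := fun n => by
    rw [Finset.mul_sum]
    refine Finset.sum_congr rfl fun i _ => ?_
    rw [div_rpow_eq_mul_neg ha.le (by positivity)]
    field_simp
  have h : ∀ n : ℕ, a ^ β / (β - 1) * ((a + 2) ^ (1 - β) - (a + 2 + n) ^ (1 - β)) ≤
      ∑ i ∈ Finset.range n, (a / (a + 2 + i)) ^ β := fun n => by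
    rw [e]
    refine mul_le_mul_of_nonneg_left ?_ (by positivity)
    have : ∀ i ∈ Finset.range n, (a + 2 + i) ^ (1 - β) - (a + 2 + (i + 1 : ℕ)) ^ (1 - β) ≤
        (β - 1) * (a + 2 + i) ^ (-β) := fun i _ => by
      push_cast
      rw [← add_assoc]
      exact le_rpow_neg hβ (by positivity)
    refine le_trans (le_of_eq ?_) (Finset.sum_le_sum this)
    rw [Finset.sum_range_sub' (fun i : ℕ => (a + 2 + i) ^ (1 - β))]
    simp
  have hlim : Tendsto (fun n : ℕ => a ^ β / (β - 1) * ((a + 2) ^ (1 - β) - (a + 2 + n) ^ (1 - β)))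
      atTop (𝓝 (a ^ β / (β - 1) * ((a + 2) ^ (1 - β) - 0))) := by
    refine (tendsto_const_nhds.sub ?_).const_mul _
    have h1 : Tendsto (fun n : ℕ => a + 2 + (n : ℝ)) atTop atTop :=
      tendsto_atTop_add_const_left _ _ tendsto_natCast_atTop_atTop
    have h2 := (tendsto_rpow_neg_atTop hb).comp h1
    simpa [Function.comp_def] using h2
  have hval : a / (β - 1) - 2 ≤ a ^ β / (β - 1) * ((a + 2) ^ (1 - β) - 0) := by
    have h1 := one_add_mul_le_one_add_rpow_of_nonpos (x := 2 / a) (p := 1 - β)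
      (by have : 0 < 2 / a := by positivity
          linarith) (by linarith)
    have e1 : a ^ β * (a + 2) ^ (1 - β) = a * (1 + 2 / a) ^ (1 - β) := by
      have : a + 2 = a * (1 + 2 / a) := by field_simp
      rw [this, Real.mul_rpow ha.le (by positivity), ← mul_assoc, ← Real.rpow_add ha]
      simp
    have h2 := mul_le_mul_of_nonneg_left h1 ha.le
    rw [sub_zero, div_mul_eq_mul_div, e1, le_div_iff₀ hb, sub_mul, div_mul_cancel₀ _ hb.ne']
    refine le_trans (le_of_eq ?_) h2
    field_simp
    ring
  obtain ⟨n, hn⟩ := (hlim.eventually_const_lt (u := a / (β - 1) - 3) (by linarith)).exists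
  exact ⟨n, hn.le.trans (h n)⟩

/-! ### Exponential moments of independent Poisson counts -/

/-- Law of the cell counts: independent Poisson variables of mean `h`. -/
def cellLaw (h : ℝ) : Measure (ℕ → ℕ∞) := Measure.infinitePi fun _ : ℕ => poissonENat h

instance (h : ℝ) : IsProbabilityMeasure (cellLaw h) := by unfold cellLaw; infer_instance

lemma lintegral_prod_cellLaw (h : ℝ) (f : ℕ → ℕ∞ → ℝ≥0∞) (K : ℕ) :
    ∫⁻ ν, ∏ m ∈ Finset.range K, f m (ν m) ∂(cellLaw h) =
      ∏ m ∈ Finset.range K, ∫⁻ n, f m n ∂(poissonENat h) := by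
  have hi := iIndepFun_infinitePi (P := fun _ : ℕ => poissonENat h) (X := fun _ n => n)
    (fun _ => measurable_id)
  have hA : Pairwise (fun i j : ℕ => Disjoint ({i} : Set ℕ) {j}) :=
    fun i j hij => Set.disjoint_singleton.2 hij
  refine (lintegral_finsetProd_of_iIndep (fun m => (measurable_pi_apply m).comap_le) hi hA
    (f := fun m ν => f m (ν m)) (fun m => ?_) (Finset.range K)).trans ?_
  · exact measurable_from_top.comp (measurable_biSup_comap (G := fun m (ν : ℕ → ℕ∞) => ν m) rfl)
  · refine Finset.prod_congr rfl fun m _ => ?_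
    have := measurePreserving_eval_infinitePi (fun _ : ℕ => poissonENat h) m
    exact this.lintegral_comp (measurable_from_top (f := f m))

open Classical in
/-- On the event that the first nonempty cell is `k`, an upper bound for exponential moments. -/
lemma lintegral_isFirst_expE_le {a : ℕ → ℝ} (ha : ∀ m, 0 ≤ a m) (k : ℕ) {B : ℝ}
    (hB : ∀ K, ∑ i ∈ Finset.range K, (Real.exp (a (k + i)) - 1) ≤ B) :
    ∫⁻ ν, (if IsFirst ν k then expE (∑' m, (if k ≤ m then ENNReal.ofReal (a m) else 0) *
      (ν m : ℝ≥0∞)) else 0) ∂(cellLaw 1) ≤ ENNReal.ofReal (Real.exp (-k + B)) := by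
  set w : ℕ → ℝ≥0∞ := fun m => if k ≤ m then ENNReal.ofReal (a m) else 0 with hw
  -- The cells before `k` are forced to be empty, which costs `e^{-k}`; the requirement that cell
  -- `k` be occupied is dropped.
  set f : ℕ → ℕ∞ → ℝ≥0∞ := fun m n => if m < k then (if n = 0 then 1 else 0) else expE (w m * n)
    with hf
  have hmeas : ∀ K, Measurable fun ν : ℕ → ℕ∞ =>
      if IsFirst ν k then expE (∑ m ∈ Finset.range K, w m * (ν m : ℝ≥0∞)) else 0 := fun K => by
    refine Measurable.ite (measurableSet_isFirst k) (measurable_expE.comp ?_) measurable_const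
    exact Finset.measurable_fun_sum _ fun m _ => ((measurable_from_top
      (f := fun n : ℕ∞ => (n : ℝ≥0∞))).comp (measurable_pi_apply m)).const_mul _
  have hint : ∀ K, ∫⁻ ν, (if IsFirst ν k then expE (∑ m ∈ Finset.range (k + K),
      w m * (ν m : ℝ≥0∞)) else 0) ∂(cellLaw 1) ≤ ENNReal.ofReal (Real.exp (-k + B)) := fun K => by
    have h1 : ∀ ν : ℕ → ℕ∞, (if IsFirst ν k then expE (∑ m ∈ Finset.range (k + K),
        w m * (ν m : ℝ≥0∞)) else 0) ≤ ∏ m ∈ Finset.range (k + K), f m (ν m) := fun ν => by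
      split_ifs with h
      · rw [expE_sum]
        refine Finset.prod_le_prod' fun m _ => ?_
        rcases lt_or_ge m k with hm | hm
        · simp [hf, hw, hm, h.2 m hm, expE_zero]
        · simp [hf, not_lt.2 hm]
      · exact zero_le
    refine (lintegral_mono h1).trans ?_
    rw [lintegral_prod_cellLaw, Finset.prod_range_add]
    have h2 : ∏ m ∈ Finset.range k, ∫⁻ n, f m n ∂(poissonENat 1) =
        ENNReal.ofReal (Real.exp (-1)) ^ k := by
      rw [Finset.prod_eq_pow_card (b := ENNReal.ofReal (Real.exp (-1))), Finset.card_range]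
      intro m hm
      rw [← poissonENat_singleton_zero zero_le_one,
        ← lintegral_indicator_one (measurableSet_singleton (0 : ℕ∞))]
      refine lintegral_congr fun n => ?_
      simp [hf, Finset.mem_range.1 hm, Set.indicator_apply]
    have h3 : ∏ i ∈ Finset.range K, ∫⁻ n, f (k + i) n ∂(poissonENat 1) =
        ENNReal.ofReal (Real.exp (∑ i ∈ Finset.range K, (Real.exp (a (k + i)) - 1))) := by
      rw [Real.exp_sum, ENNReal.ofReal_prod_of_nonneg fun i _ => (Real.exp_pos _).le]
      refine Finset.prod_congr rfl fun i _ => ?_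
      have := lintegral_expE_mul_poissonENat zero_le_one (ha (k + i))
      rw [one_mul] at this
      rw [← this]
      refine lintegral_congr fun n => ?_
      simp [hf, hw]
    rw [h2, h3, ← ENNReal.ofReal_pow (Real.exp_pos _).le, ← Real.exp_nat_mul,
      ← ENNReal.ofReal_mul (Real.exp_pos _).le, ← Real.exp_add]
    refine ENNReal.ofReal_le_ofReal (Real.exp_le_exp.2 ?_)
    have := hB K
    linarith
  refine le_of_tendsto' (lintegral_tendsto_of_tendsto_of_monotone
    (f := fun K ν => if IsFirst ν k then expE (∑ m ∈ Finset.range (k + K),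
      w m * (ν m : ℝ≥0∞)) else 0) (fun K => (hmeas _).aemeasurable) ?_ ?_) hint
  · refine ae_of_all _ fun ν K L hKL => ?_
    dsimp only
    split_ifs
    · exact expE_mono (Finset.sum_le_sum_of_subset (Finset.range_mono (by omega)))
    · exact le_rfl
  · refine ae_of_all _ fun ν => ?_
    split_ifs
    · refine (tendsto_expE_sum _).comp (tendsto_atTop_mono (fun K => ?_) tendsto_id)
      exact Nat.le_add_left K k
    · exact tendsto_const_nhds

open Classical in
/-- On the event that the first nonempty cell is `k`, a lower bound for exponential moments. -/
lemma le_lintegral_isFirst_expE {a : ℕ → ℝ} (ha : ∀ m, 0 ≤ a m) (k K : ℕ) :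
    ENNReal.ofReal (1 - Real.exp (-1)) * ENNReal.ofReal (Real.exp (-k +
      ∑ i ∈ Finset.range K, (Real.exp (a (k + 1 + i)) - 1))) ≤
    ∫⁻ ν, (if IsFirst ν k then expE (∑' m, (if k < m then ENNReal.ofReal (a m) else 0) *
      (ν m : ℝ≥0∞)) else 0) ∂(cellLaw 1) := by
  set w : ℕ → ℝ≥0∞ := fun m => if k < m then ENNReal.ofReal (a m) else 0 with hw
  -- Here cell `k` must be occupied, which gives the factor `1 - e^{-1}`; it has weight zero, so it
  -- does not affect the moment otherwise.
  set f : ℕ → ℕ∞ → ℝ≥0∞ := fun m n => if m < k then (if n = 0 then 1 else 0) else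
    if m = k then (if n = 0 then 0 else 1) else expE (w m * n) with hf
  have h1 : ∀ ν : ℕ → ℕ∞, ∏ m ∈ Finset.range (k + 1 + K), f m (ν m) ≤
      if IsFirst ν k then expE (∑' m, w m * (ν m : ℝ≥0∞)) else 0 := fun ν => by
    split_ifs with h
    · refine le_trans ?_ (expE_mono (ENNReal.sum_le_tsum (Finset.range (k + 1 + K))))
      rw [expE_sum]
      refine Finset.prod_le_prod' fun m _ => ?_
      rcases lt_trichotomy m k with hm | hm | hm
      · simp [hf, hw, hm, h.2 m hm, expE_zero]
      · subst hm
        simp [hf, hw, h.1, expE_zero]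
      · simp [hf, not_lt.2 hm.le, hm.ne']
    · rw [nonpos_iff_eq_zero]
      rw [IsFirst, not_and_or] at h
      rcases h with h | h
      · refine Finset.prod_eq_zero (i := k) (by simp; omega) ?_
        simp [hf, not_not.1 h]
      · push Not at h
        obtain ⟨m, hm, hm'⟩ := h
        refine Finset.prod_eq_zero (i := m) (by simp; omega) ?_
        simp [hf, hm, hm']
  refine le_trans (le_of_eq ?_) (lintegral_mono h1)
  rw [lintegral_prod_cellLaw, Finset.prod_range_add, Finset.prod_range_succ]
  have h2 : ∏ m ∈ Finset.range k, ∫⁻ n, f m n ∂(poissonENat 1) =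
      ENNReal.ofReal (Real.exp (-1)) ^ k := by
    rw [Finset.prod_eq_pow_card (b := ENNReal.ofReal (Real.exp (-1))), Finset.card_range]
    intro m hm
    rw [← poissonENat_singleton_zero zero_le_one,
      ← lintegral_indicator_one (measurableSet_singleton (0 : ℕ∞))]
    refine lintegral_congr fun n => ?_
    simp [hf, Finset.mem_range.1 hm, Set.indicator_apply]
  have h4 : ∫⁻ n, f k n ∂(poissonENat 1) = ENNReal.ofReal (1 - Real.exp (-1)) := by
    rw [← poissonENat_ne_zero zero_le_one,
      ← lintegral_indicator_one (show MeasurableSet {n : ℕ∞ | n ≠ 0} from trivial)]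
    refine lintegral_congr fun n => ?_
    by_cases hn : n = 0 <;> simp [hf, hn]
  have h3 : ∏ i ∈ Finset.range K, ∫⁻ n, f (k + 1 + i) n ∂(poissonENat 1) =
      ENNReal.ofReal (Real.exp (∑ i ∈ Finset.range K, (Real.exp (a (k + 1 + i)) - 1))) := by
    rw [Real.exp_sum, ENNReal.ofReal_prod_of_nonneg fun i _ => (Real.exp_pos _).le]
    refine Finset.prod_congr rfl fun i _ => ?_
    have := lintegral_expE_mul_poissonENat zero_le_one (ha (k + 1 + i))
    rw [one_mul] at this
    rw [← this]
    refine lintegral_congr fun n => ?_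
    have e1 : ¬ k + 1 + i < k := by omega
    have e2 : ¬ k + 1 + i = k := by omega
    have e3 : k < k + 1 + i := by omega
    simp only [hf, hw, if_neg e1, if_neg e2, if_pos e3]
  rw [h2, h3, h4, ← ENNReal.ofReal_pow (Real.exp_pos _).le, ← Real.exp_nat_mul, mul_comm _
    (ENNReal.ofReal (1 - Real.exp (-1))), mul_assoc,
    ← ENNReal.ofReal_mul (Real.exp_pos _).le, ← Real.exp_add]
  congr 4
  ring

/-- An exponential moment with negative exponent vanishes if the rates are not summable. -/
lemma lintegral_inv_expE_eq_zero {h : ℝ} (hh : 0 < h) {a : ℕ → ℝ} (ha : ∀ m, 0 ≤ a m)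
    (hdiv : Tendsto (fun K => ∑ m ∈ Finset.range K, (1 - Real.exp (-a m))) atTop atTop) :
    ∫⁻ ν, (expE (∑' m, ENNReal.ofReal (a m) * (ν m : ℝ≥0∞)))⁻¹ ∂(cellLaw h) = 0 := by
  have hle : ∀ K, ∫⁻ ν, (expE (∑' m, ENNReal.ofReal (a m) * (ν m : ℝ≥0∞)))⁻¹ ∂(cellLaw h) ≤
      ENNReal.ofReal (Real.exp (-(h * ∑ m ∈ Finset.range K, (1 - Real.exp (-a m))))) := fun K => by
    have h1 : ∀ ν : ℕ → ℕ∞, (expE (∑' m, ENNReal.ofReal (a m) * (ν m : ℝ≥0∞)))⁻¹ ≤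
        ∏ m ∈ Finset.range K, (expE (ENNReal.ofReal (a m) * (ν m : ℝ≥0∞)))⁻¹ := fun ν => by
      rw [← inv_expE_sum]
      exact ENNReal.inv_le_inv.2 (expE_mono (ENNReal.sum_le_tsum _))
    refine (lintegral_mono h1).trans (le_of_eq ?_)
    rw [lintegral_prod_cellLaw h (fun m n => (expE (ENNReal.ofReal (a m) * (n : ℝ≥0∞)))⁻¹) K,
      Finset.mul_sum, ← Finset.sum_neg_distrib, Real.exp_sum,
      ENNReal.ofReal_prod_of_nonneg fun i _ => (Real.exp_pos _).le]
    refine Finset.prod_congr rfl fun m _ => ?_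
    rw [lintegral_inv_expE_mul_poissonENat hh.le (ha m)]
    congr 2; ring
  have hlim : Tendsto (fun K => ENNReal.ofReal (Real.exp (-(h * ∑ m ∈ Finset.range K,
      (1 - Real.exp (-a m)))))) atTop (𝓝 0) := by
    have := Real.tendsto_exp_neg_atTop_nhds_zero.comp (hdiv.const_mul_atTop hh)
    simpa using ENNReal.tendsto_ofReal this
  exact le_antisymm (ge_of_tendsto' hlim hle) zero_le

open Classical in
lemma measurable_ite_isFirst_expE (w : ℕ → ℝ≥0∞) (k : ℕ) : Measurable fun ν : ℕ → ℕ∞ =>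
    if IsFirst ν k then expE (∑' m, w m * (ν m : ℝ≥0∞)) else 0 := by
  refine Measurable.ite (measurableSet_isFirst k) (measurable_expE.comp ?_) measurable_const
  exact Measurable.tsum fun m => ((measurable_from_top
    (f := fun n : ℕ∞ => (n : ℝ≥0∞))).comp (measurable_pi_apply m)).const_mul _

open Classical in
lemma tsum_isFirst_eq {ν : ℕ → ℕ∞} {k : ℕ} (hk : IsFirst ν k) (g : ℕ → ℝ≥0∞) :
    ∑' l, (if IsFirst ν l then g l else 0) = g k := by
  rw [tsum_eq_single k, if_pos hk]
  exact fun l hl => if_neg fun h => hl (h.unique hk)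

/-- Bernoulli's inequality `(1 + t) ^ s ≤ 1 + s t` for `0 ≤ s ≤ 1`; this is where `s ≤ 1` enters the
moment bound. -/
lemma exp_mul_log_one_add_sub_one_le {s t : ℝ} (hs : 0 ≤ s) (hs1 : s ≤ 1) (ht : 0 ≤ t) :
    Real.exp (s * Real.log (1 + t)) - 1 ≤ s * t := by
  have h := rpow_one_add_le_one_add_mul_self (s := t) (p := s) (by linarith) hs hs1
  rw [Real.rpow_def_of_pos (by linarith), mul_comm] at h
  linarith

/-- The first two terms equal `1` by truncation; the remaining ones fall under the integral
comparison. -/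
lemma sum_upper_weights_le {β : ℝ} (hβ : 1 < β) (k K : ℕ) :
    ∑ i ∈ Finset.range K, (((k : ℝ) + 1) / max ((k + i : ℕ) : ℝ) (k + 1)) ^ β ≤
      2 + (k + 1) / (β - 1) := by
  have h1 : ∑ i ∈ Finset.range K, (((k : ℝ) + 1) / max ((k + i : ℕ) : ℝ) (k + 1)) ^ β ≤
      ∑ i ∈ Finset.range (K + 2), (((k : ℝ) + 1) / max ((k + i : ℕ) : ℝ) (k + 1)) ^ β :=
    Finset.sum_le_sum_of_subset_of_nonneg (Finset.range_mono (by omega))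
      fun i _ _ => by positivity
  refine h1.trans ?_
  rw [Finset.sum_range_succ', Finset.sum_range_succ']
  have h0 : ((k : ℝ) + 1) / (k + 1) = 1 := div_self (by positivity)
  have h2 : ∑ i ∈ Finset.range K, (((k : ℝ) + 1) / max ((k + (i + 1 + 1) : ℕ) : ℝ) (k + 1)) ^ β ≤
      (k + 1) / (β - 1) := by
    refine le_trans (le_of_eq (Finset.sum_congr rfl fun i _ => ?_))
      (sum_shift_rpow_le hβ (by positivity : (0 : ℝ) < k + 1) K)
    rw [max_eq_left (by push_cast; linarith [(Nat.cast_nonneg i : (0 : ℝ) ≤ i)])]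
    congr 2
    push_cast; ring
  have h3 : (((k : ℝ) + 1) / max ((k + (0 + 1) : ℕ) : ℝ) (k + 1)) ^ β = 1 := by
    push_cast
    rw [max_self, h0, Real.one_rpow]
  have h4 : (((k : ℝ) + 1) / max ((k + 0 : ℕ) : ℝ) (k + 1)) ^ β = 1 := by
    rw [add_zero, max_eq_right (by linarith), h0, Real.one_rpow]
  rw [h3, h4]
  linarith

/-- With `p = e^{-t}`, `(1 - p) ^ N ≤ e^{-pN} ≤ (pN)^{-s}`, the last step because `s log y ≤ y` for
`0 < s ≤ 1`. It turns exponential moments of the loss into polynomial decay in `N`. -/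
lemma one_sub_inv_expE_pow_le {s : ℝ} (hs : 0 < s) (hs1 : s ≤ 1) {N : ℕ} (hN : 1 ≤ N)
    (t : ℝ≥0∞) : (1 - (expE t)⁻¹) ^ N ≤
      ENNReal.ofReal ((N : ℝ) ^ (-s)) * expE (ENNReal.ofReal s * t) := by
  have hN' : (0 : ℝ) < N := by exact_mod_cast hN
  induction t with
  | top =>
    rw [ENNReal.mul_top (by simpa using hs), expE_top, ENNReal.mul_top]
    · exact le_top
    · simpa using Real.rpow_pos_of_pos hN' (-s)
  | coe x =>
    rw [← ENNReal.ofReal_coe_nnreal, ← ENNReal.ofReal_mul hs.le, expE_ofReal x.coe_nonneg,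
      expE_ofReal (by positivity), ← ENNReal.ofReal_mul (by positivity),
      ← ENNReal.ofReal_inv_of_pos (Real.exp_pos _), ← Real.exp_neg, ← ENNReal.ofReal_one,
      ← ENNReal.ofReal_sub _ (Real.exp_pos _).le, ← ENNReal.ofReal_pow]
    swap
    · rw [sub_nonneg, Real.exp_le_one_iff]; simp
    refine ENNReal.ofReal_le_ofReal ?_
    set p := Real.exp (-(x : ℝ)) with hp
    have hp0 : 0 < p := Real.exp_pos _
    have hp1 : p ≤ 1 := by rw [hp, Real.exp_le_one_iff]; simp
    have h1 : (1 - p) ^ N ≤ Real.exp (-(p * N)) := by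
      rw [show -(p * N) = N * (-p) by ring, Real.exp_nat_mul]
      exact pow_le_pow_left₀ (by linarith) (Real.one_sub_le_exp_neg p) N
    refine h1.trans ?_
    rw [Real.rpow_def_of_pos hN', ← Real.exp_add, Real.exp_le_exp]
    have hlog : Real.log (p * N) = -x + Real.log N := by
      rw [Real.log_mul hp0.ne' hN'.ne', hp, Real.log_exp]
    have h2 := Real.log_le_sub_one_of_pos (by positivity : 0 < p * N)
    have h3 : 0 < p * N := by positivity
    rw [hlog] at h2
    nlinarith

/-! ### Moments of the loss and the phase transition -/

section
variable {Ω : Type*} [MeasurableSpace Ω] {P : Measure Ω}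
  {X : ℕ → Ω → ℂ} {F : ℕ → ℕ → Ω → ℝ} {C α Γ lam : ℝ}

lemma IsPoissonProcess.lintegral_cellCount (hX : IsPoissonProcess P lam X) (hlam : 0 < lam) (q : ℕ)
    {G : (ℕ → ℕ∞) → ℝ≥0∞} (hG : Measurable G) :
    ∫⁻ ω, G (cellCount (fun j => X j ω) (lam * Real.pi * (q + 1)) Set.univ) ∂P =
      ∫⁻ ν, G ν ∂(cellLaw (1 / (q + 1))) := by
  have := hX.lintegral_cells hlam le_rfl q (0 : Fin 1) hG
  simpa [sector_one, cellLaw] using this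

lemma IsPoissonProcess.lintegral_cellCount_one (hX : IsPoissonProcess P lam X) (hlam : 0 < lam)
    {G : (ℕ → ℕ∞) → ℝ≥0∞} (hG : Measurable G) :
    ∫⁻ ω, G (cellCount (fun j => X j ω) (lam * Real.pi) Set.univ) ∂P =
      ∫⁻ ν, G ν ∂(cellLaw 1) := by
  have := hX.lintegral_cellCount hlam 0 hG
  simpa using this

variable [IsProbabilityMeasure P]

lemma IsPoissonProcess.ae_isRegular_univ (hX : IsPoissonProcess P lam X) (hlam : 0 < lam) :
    ∀ᵐ ω ∂P, IsRegular (fun j => X j ω) Set.univ := by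
  simpa [sector_one] using hX.ae_isRegular hlam le_rfl (0 : Fin 1)

lemma aemeasurable_logLoss (hX : IsPoissonProcess P lam X) (hlam : 0 < lam) (hα : 0 < α)
    (hΓ : 0 < Γ) : AEMeasurable (fun ω => logLoss α Γ Set.univ fun j => X j ω) P := by
  have hc : 0 < lam * Real.pi := mul_pos hlam Real.pi_pos
  refine aemeasurable_of_tendsto_metrizable_ae atTop (f := fun (q : ℕ) ω => cellLoss α Γ
    (cellCount (fun j => X j ω) (lam * Real.pi * (q + 1)) Set.univ)) (fun q => ?_) ?_
  · exact (measurable_comp_pi (measurable_cellLoss α Γ) fun m =>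
      hX.measurable_count (measurableSet_cell MeasurableSet.univ m)).aemeasurable
  · filter_upwards [hX.ae_isRegular_univ hlam] with ω hω
    exact tendsto_cellLoss hα hΓ hc hω

/-- With cells of mean `1`, the event that cell `k` is the first occupied one contributes at most a
constant times `e^{-k} e^{k s Γ / (α/2 - 1)}`, and the resulting geometric series converges. -/
lemma lintegral_expE_logLoss_lt_top (hX : IsPoissonProcess P lam X) (hlam : 0 < lam) (hα : 2 < α)
    (hΓ : 0 < Γ) {s : ℝ} (hs : 0 < s) (hs1 : s ≤ 1) (hsΓ : s * Γ < α / 2 - 1) :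
    ∫⁻ ω, expE (ENNReal.ofReal s * logLoss α Γ Set.univ fun j => X j ω) ∂P < ∞ := by
  classical
  have hc : 0 < lam * Real.pi := mul_pos hlam Real.pi_pos
  have hβ : 0 < α / 2 - 1 := by linarith
  set a : ℕ → ℕ → ℝ := fun k m =>
    s * Real.log (1 + Γ * (((k : ℝ) + 1) / max (m : ℝ) (k + 1)) ^ (α / 2)) with ha
  have ha0 : ∀ k m, 0 ≤ a k m := fun k m => by
    refine mul_nonneg hs.le (Real.log_nonneg ?_)
    have : 0 ≤ Γ * (((k : ℝ) + 1) / max (m : ℝ) (k + 1)) ^ (α / 2) := by positivity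
    linarith
  set U : (ℕ → ℕ∞) → ℝ≥0∞ := fun ν => ∑' k, if IsFirst ν k then
    expE (∑' m, (if k ≤ m then ENNReal.ofReal (a k m) else 0) * (ν m : ℝ≥0∞)) else 0 with hU
  have hUm : Measurable U := Measurable.tsum fun k => measurable_ite_isFirst_expE _ k
  have hle : ∀ᵐ ω ∂P, expE (ENNReal.ofReal s * logLoss α Γ Set.univ fun j => X j ω) ≤
      U (cellCount (fun j => X j ω) (lam * Real.pi) Set.univ) := by
    filter_upwards [hX.ae_isRegular_univ hlam] with ω hω
    obtain ⟨j, hj, -⟩ := id hω.existsUnique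
    have hk := isFirst_cellCount hc hj
    rw [hU]
    simp only []
    rw [tsum_isFirst_eq hk]
    refine expE_mono ?_
    refine (mul_le_mul_right (logLoss_le_tsum_cellCount (by linarith) hΓ.le hc hω hk) _).trans ?_
    rw [← ENNReal.tsum_mul_left]
    refine ENNReal.tsum_le_tsum fun m => ?_
    rw [← mul_assoc]
    refine mul_le_mul_left (le_of_eq ?_) _
    split_ifs
    · rw [ha, ← ENNReal.ofReal_mul hs.le]
    · simp
  refine (lintegral_mono_ae hle).trans_lt ?_
  rw [hX.lintegral_cellCount_one hlam hUm, hU,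
    lintegral_tsum fun k => (measurable_ite_isFirst_expE _ k).aemeasurable]
  set B : ℕ → ℝ := fun k => s * Γ * (2 + (k + 1) / (α / 2 - 1)) with hB
  have hterm : ∀ k : ℕ, ∫⁻ ν, (if IsFirst ν k then expE (∑' m, (if k ≤ m then
      ENNReal.ofReal (a k m) else 0) * (ν m : ℝ≥0∞)) else 0) ∂(cellLaw 1) ≤
      ENNReal.ofReal (Real.exp (-k + B k)) := fun k => by
    refine lintegral_isFirst_expE_le (ha0 k) k fun K => ?_
    have h1 : ∀ i ∈ Finset.range K, Real.exp (a k (k + i)) - 1 ≤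
        s * Γ * (((k : ℝ) + 1) / max ((k + i : ℕ) : ℝ) (k + 1)) ^ (α / 2) := fun i _ => by
      rw [mul_assoc]
      exact exp_mul_log_one_add_sub_one_le hs.le hs1 (by positivity)
    refine (Finset.sum_le_sum h1).trans ?_
    rw [← Finset.mul_sum]
    exact mul_le_mul_of_nonneg_left (sum_upper_weights_le (by linarith) k K) (by positivity)
  refine (ENNReal.tsum_le_tsum hterm).trans_lt ?_
  set δ := 1 - s * Γ / (α / 2 - 1) with hδ
  have hδ0 : 0 < δ := by rw [hδ, sub_pos, div_lt_one hβ]; exact hsΓ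
  have e : ∀ k : ℕ, Real.exp (-k + B k) =
      Real.exp (s * Γ * (2 + 1 / (α / 2 - 1))) * Real.exp (-δ) ^ k := fun k => by
    rw [← Real.exp_nat_mul, ← Real.exp_add, hB, hδ]
    congr 1
    field_simp
    ring
  have hsum : Summable fun k : ℕ => Real.exp (-k + B k) := by
    simp_rw [e]
    refine (summable_geometric_of_lt_one (Real.exp_pos _).le ?_).mul_left _
    rw [← Real.exp_zero]
    exact Real.exp_lt_exp.2 (by linarith)
  exact hsum.tsum_ofReal_lt_top

/-- The void probability `e^{-k}` is compensated by the exponential moment up to a factor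
independent of `k`, so infinitely many disjoint events contribute at least a fixed positive amount
each. -/
lemma lintegral_expE_logLoss_eq_top (hX : IsPoissonProcess P lam X) (hlam : 0 < lam) (hα : 2 < α)
    (hΓ : 0 < Γ) (hαΓ : α / 2 - 1 ≤ Γ) :
    ∫⁻ ω, expE (logLoss α Γ Set.univ fun j => X j ω) ∂P = ∞ := by
  classical
  have hc : 0 < lam * Real.pi := mul_pos hlam Real.pi_pos
  have hβ : 0 < α / 2 - 1 := by linarith
  set a : ℕ → ℕ → ℝ := fun k m => Real.log (1 + Γ * ((k : ℝ) / (m + 1)) ^ (α / 2)) with ha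
  have ha0 : ∀ k m, 0 ≤ a k m := fun k m => by
    refine Real.log_nonneg ?_
    have : 0 ≤ Γ * ((k : ℝ) / (m + 1)) ^ (α / 2) := by positivity
    linarith
  have hle : ∫⁻ ν, expE (cellLoss α Γ ν) ∂(cellLaw 1) ≤
      ∫⁻ ω, expE (logLoss α Γ Set.univ fun j => X j ω) ∂P := by
    rw [← hX.lintegral_cellCount_one hlam (G := fun ν => expE (cellLoss α Γ ν)) (measurable_expE.comp (measurable_cellLoss α Γ))]
    refine lintegral_mono_ae ?_
    filter_upwards [hX.ae_isRegular_univ hlam] with ω hω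
    exact expE_mono (cellLoss_le_logLoss (by linarith) hΓ.le hc hω)
  have hpt : ∀ ν, (∑' k, if IsFirst ν k then
      expE (∑' m, (if k < m then ENNReal.ofReal (a k m) else 0) * (ν m : ℝ≥0∞)) else 0) ≤
      expE (cellLoss α Γ ν) := fun ν => by
    by_cases h : ∃ k, IsFirst ν k
    · obtain ⟨k, hk⟩ := h
      rw [tsum_isFirst_eq hk, cellLoss_eq hk]
    · have : ∀ k, ¬ IsFirst ν k := not_exists.1 h
      simp [this]
  -- The index is shifted to `k + 1` because the comparison of sum and integral needs a positive
  -- start. The constant `3 Γ` is `Γ` times the error in that comparison.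
  have hlow : ∀ k : ℕ, ENNReal.ofReal (1 - Real.exp (-1)) *
      ENNReal.ofReal (Real.exp (-(3 * Γ))) ≤ ∫⁻ ν, (if IsFirst ν (k + 1) then
        expE (∑' m, (if k + 1 < m then ENNReal.ofReal (a (k + 1) m) else 0) * (ν m : ℝ≥0∞)) else 0)
        ∂(cellLaw 1) := fun k => by
    obtain ⟨n, hn⟩ := exists_le_sum_shift_rpow (β := α / 2) (a := (k + 1 : ℕ)) (by linarith)
      (by positivity)
    refine le_trans ?_ (le_lintegral_isFirst_expE (ha0 (k + 1)) (k + 1) n)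
    gcongr
    have e : ∑ i ∈ Finset.range n, (Real.exp (a (k + 1) (k + 1 + 1 + i)) - 1) =
        Γ * ∑ i ∈ Finset.range n, (((k + 1 : ℕ) : ℝ) / ((k + 1 : ℕ) + 2 + i)) ^ (α / 2) := by
      rw [Finset.mul_sum]
      refine Finset.sum_congr rfl fun i _ => ?_
      rw [ha]
      simp only []
      rw [Real.exp_log (by positivity)]
      push_cast
      rw [add_sub_cancel_left]
      congr 3
      ring
    rw [e]
    have h1 := mul_le_mul_of_nonneg_left hn hΓ.le
    have h2 : ((k + 1 : ℕ) : ℝ) ≤ Γ * ((k + 1 : ℕ) / (α / 2 - 1)) := by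
      rw [mul_div_assoc', le_div_iff₀ hβ]
      have : (0 : ℝ) ≤ (k + 1 : ℕ) := by positivity
      nlinarith
    linarith
  rw [eq_top_iff]
  refine le_trans ?_ hle
  refine le_trans ?_ (lintegral_mono hpt)
  rw [lintegral_tsum fun k => (measurable_ite_isFirst_expE _ k).aemeasurable]
  refine le_trans ?_ (ENNReal.tsum_comp_le_tsum_of_injective (add_left_injective 1) _)
  refine le_trans ?_ (ENNReal.tsum_le_tsum hlow)
  rw [ENNReal.tsum_const_eq_top_of_ne_zero]
  simp [Real.exp_pos]

/-- With `y = Γ k / (m + 1)`, the summand for `k < m` is `y / (1 + y)`, at least `b / (m + 1)`: the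
harmonic series diverges, and the missing terms `m ≤ k` cost at most `b (k + 1)`. -/
lemma tendsto_sum_one_sub_exp_atTop (hΓ : 0 < Γ) {k : ℕ} (hk : 1 ≤ k) :
    Tendsto (fun K => ∑ m ∈ Finset.range K, (1 - Real.exp (-(if k < m then
      Real.log (1 + Γ * ((k : ℝ) / (m + 1))) else 0)))) atTop atTop := by
  have hk' : (0 : ℝ) < k := by exact_mod_cast hk
  set b := Γ * k / (1 + Γ * k) with hb
  have hb0 : 0 < b := by positivity
  have hterm : ∀ m : ℕ, (if k < m then b * (1 / ((m : ℝ) + 1)) else 0) ≤ 1 - Real.exp (-(if k < m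
      then Real.log (1 + Γ * ((k : ℝ) / (m + 1))) else 0)) := fun m => by
    split_ifs
    · rw [Real.exp_neg, Real.exp_log (by positivity)]
      have e : 1 - (1 + Γ * ((k : ℝ) / (m + 1)))⁻¹ = Γ * k / (m + 1 + Γ * k) := by
        have h1 : 1 + Γ * ((k : ℝ) / (m + 1)) = (m + 1 + Γ * k) / (m + 1) := by field_simp
        rw [h1, inv_div, eq_div_iff (by positivity), sub_mul, div_mul_cancel₀ _ (by positivity)]
        ring
      rw [e, hb, div_mul_div_comm, mul_one]
      refine div_le_div_of_nonneg_left (by positivity) (by positivity) ?_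
      nlinarith [mul_nonneg (mul_nonneg hΓ.le hk'.le) (Nat.cast_nonneg m : (0 : ℝ) ≤ m)]
    · simp
  have hsum : ∀ K, b * ∑ m ∈ Finset.range K, (1 / ((m : ℝ) + 1)) - b * (k + 1) ≤
      ∑ m ∈ Finset.range K, (if k < m then b * (1 / ((m : ℝ) + 1)) else 0) := fun K => by
    have h1 : ∀ m ∈ Finset.range K, b * (1 / ((m : ℝ) + 1)) - (if m < k + 1 then b else 0) ≤
        if k < m then b * (1 / ((m : ℝ) + 1)) else 0 := fun m _ => by
      by_cases h : k < m
      · rw [if_pos h, if_neg (by omega), sub_zero]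
      · rw [if_neg h, if_pos (by omega), sub_nonpos]
        refine mul_le_of_le_one_right hb0.le ?_
        rw [div_le_one (by positivity)]
        linarith [(Nat.cast_nonneg m : (0 : ℝ) ≤ m)]
    refine le_trans ?_ (Finset.sum_le_sum h1)
    rw [Finset.sum_sub_distrib, ← Finset.mul_sum, ← Finset.sum_filter, Finset.sum_const,
      nsmul_eq_mul, mul_comm _ b]
    refine sub_le_sub_left (mul_le_mul_of_nonneg_left ?_ hb0.le) _
    have : (Finset.filter (fun m => m < k + 1) (Finset.range K)).card ≤ k + 1 := by
      rw [← Finset.card_range (k + 1)]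
      exact Finset.card_le_card fun m hm => by simpa using (Finset.mem_filter.1 hm).2
    exact_mod_cast this
  refine tendsto_atTop_mono (fun K => (hsum K).trans (Finset.sum_le_sum fun m _ => hterm m)) ?_
  have := Real.tendsto_sum_range_one_div_nat_succ_atTop
  exact tendsto_atTop_add_const_right _ _ (this.const_mul_atTop hb0)

/-- If the first occupied cell has index at least `1`, the loss dominates a divergent Poisson sum.
Index `0` carries no information, its weights being zero, but has probability `1 - e^{-1/(q+1)}`,
which vanishes under refinement. -/
lemma lintegral_inv_expE_logLoss_two (hX : IsPoissonProcess P lam X) (hlam : 0 < lam)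
    (hΓ : 0 < Γ) : ∫⁻ ω, (expE (logLoss 2 Γ Set.univ fun j => X j ω))⁻¹ ∂P = 0 := by
  classical
  have hle : ∀ q : ℕ, ∫⁻ ω, (expE (logLoss 2 Γ Set.univ fun j => X j ω))⁻¹ ∂P ≤
      ENNReal.ofReal (1 - Real.exp (-(1 / ((q : ℝ) + 1)))) := fun q => by
    have hc : 0 < lam * Real.pi * (q + 1) := by have := Real.pi_pos; positivity
    have hh : 0 < 1 / ((q : ℝ) + 1) := by positivity
    set a : ℕ → ℕ → ℝ := fun k m =>
      if k < m then Real.log (1 + Γ * ((k : ℝ) / (m + 1))) else 0 with ha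
    have ha0 : ∀ k m, 0 ≤ a k m := fun k m => by
      rw [ha]
      simp only []
      split_ifs
      · refine Real.log_nonneg ?_
        have : 0 ≤ Γ * ((k : ℝ) / (m + 1)) := by positivity
        linarith
      · exact le_rfl
    set V : ℕ → (ℕ → ℕ∞) → ℝ≥0∞ := fun k ν =>
      (expE (∑' m, ENNReal.ofReal (a k m) * (ν m : ℝ≥0∞)))⁻¹ with hV
    have hVm : ∀ k, Measurable (V k) := fun k => measurable_inv_expE.comp
      (Measurable.tsum fun m => ((measurable_from_top
        (f := fun n : ℕ∞ => (n : ℝ≥0∞))).comp (measurable_pi_apply m)).const_mul _)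
    have hm0 : MeasurableSet {ν : ℕ → ℕ∞ | ν 0 ≠ 0} :=
      (measurable_pi_apply (X := fun _ : ℕ => ℕ∞) 0)
        (show MeasurableSet {n : ℕ∞ | n ≠ 0} from trivial)
    -- The random index of the first cell is removed by summing over all its possible values `k +
    -- 1`; each summand has integral zero.
    set G : (ℕ → ℕ∞) → ℝ≥0∞ := fun ν => {ν : ℕ → ℕ∞ | ν 0 ≠ 0}.indicator 1 ν + ∑' k, V (k + 1) ν
      with hG
    have hGm : Measurable G :=
      (measurable_one.indicator hm0).add (Measurable.tsum fun k => hVm (k + 1))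
    have hpt : ∀ᵐ ω ∂P, (expE (logLoss 2 Γ Set.univ fun j => X j ω))⁻¹ ≤
        G (cellCount (fun j => X j ω) (lam * Real.pi * (q + 1)) Set.univ) := by
      filter_upwards [hX.ae_isRegular_univ hlam] with ω hω
      obtain ⟨j, hj, -⟩ := id hω.existsUnique
      have hk := isFirst_cellCount hc hj
      have hloss := cellLoss_le_logLoss (α := 2) zero_le_two hΓ.le hc hω
      rcases Nat.eq_zero_or_pos (annulusIdx (lam * Real.pi * (q + 1)) (X j ω)) with h0 | h0
      · rw [h0] at hk
        refine (inv_expE_le_one _).trans (le_trans ?_ le_self_add)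
        rw [Set.indicator_of_mem (show cellCount (fun j => X j ω) (lam * Real.pi * (q + 1)) Set.univ ∈
          {ν : ℕ → ℕ∞ | ν 0 ≠ 0} from hk.1)]
        exact le_rfl
      · obtain ⟨k, hk1⟩ := Nat.exists_eq_succ_of_ne_zero h0.ne'
        rw [hk1] at hk
        refine le_trans ?_ le_add_self
        refine le_trans ?_ (ENNReal.le_tsum k)
        refine ENNReal.inv_le_inv.2 (expE_mono (le_trans (le_of_eq ?_) hloss))
        rw [cellLoss_eq hk]
        refine tsum_congr fun m => ?_
        rw [ha]
        simp only [div_self (two_ne_zero' ℝ), Real.rpow_one]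
        split_ifs <;> simp
    refine (lintegral_mono_ae hpt).trans (le_of_eq ?_)
    rw [hX.lintegral_cellCount hlam q hGm, hG,
      lintegral_add_left (measurable_one.indicator hm0), lintegral_indicator_one hm0,
      lintegral_tsum fun k => (hVm (k + 1)).aemeasurable]
    have hV0 : ∀ k, ∫⁻ ν, V (k + 1) ν ∂(cellLaw (1 / ((q : ℝ) + 1))) = 0 := fun k =>
      lintegral_inv_expE_eq_zero hh (ha0 (k + 1)) (tendsto_sum_one_sub_exp_atTop hΓ (by omega))
    simp_rw [hV0]
    rw [tsum_zero, add_zero, ← poissonENat_ne_zero hh.le]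
    exact (measurePreserving_eval_infinitePi (fun _ : ℕ => poissonENat (1 / ((q : ℝ) + 1)))
      0).measure_preimage (s := {n | n ≠ 0}) (MeasurableSet.nullMeasurableSet trivial)
  have hlim : Tendsto (fun q : ℕ => ENNReal.ofReal (1 - Real.exp (-(1 / ((q : ℝ) + 1))))) atTop
      (𝓝 0) := by
    have h1 := (tendsto_one_div_add_atTop_nhds_zero_nat (𝕜 := ℝ)).neg
    have h2 := (Real.continuous_exp.tendsto _).comp h1
    have h3 := ENNReal.tendsto_ofReal (h2.const_sub 1)
    simpa [Function.comp_def] using h3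
  exact le_antisymm (ge_of_tendsto' hlim hle) zero_le

lemma missProb_two (hX : IsPoissonProcess P lam X) (hlam : 0 < lam) (hΓ : 0 < Γ) (N : ℕ) :
    missProb P 2 Γ X N = 1 := by
  have hm : AEMeasurable (fun ω => (expE (logLoss 2 Γ Set.univ fun j => X j ω))⁻¹) P :=
    measurable_inv_expE.comp_aemeasurable (aemeasurable_logLoss hX hlam two_pos hΓ)
  have h0 := (lintegral_eq_zero_iff' hm).1 (lintegral_inv_expE_logLoss_two hX hlam hΓ)
  rw [missProb, lintegral_congr_ae (g := fun _ => 1)]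
  · simp
  · filter_upwards [h0] with ω hω
    rw [hω]; simp

/-- Given the locations, the waiting time for one sector is geometric with success probability
`e^{-L}` and mean `e^L`. -/
lemma tsum_missProb (hX : IsPoissonProcess P lam X) (hlam : 0 < lam) (hα : 0 < α) (hΓ : 0 < Γ) :
    ∑' N, missProb P α Γ X N = ∫⁻ ω, expE (logLoss α Γ Set.univ fun j => X j ω) ∂P := by
  have hm := aemeasurable_logLoss hX hlam hα hΓ
  simp_rw [missProb]
  rw [← lintegral_tsum (f := fun N ω => (1 - (expE (logLoss α Γ Set.univ fun j => X j ω))⁻¹) ^ N)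
    fun N => ((measurable_inv_expE.const_sub 1).pow_const N).comp_aemeasurable hm]
  refine lintegral_congr fun ω => ?_
  rw [ENNReal.tsum_geometric, ENNReal.sub_sub_cancel ENNReal.one_ne_top (inv_expE_le_one _),
    inv_inv]

lemma missProb_le (hX : IsPoissonProcess P lam X) (hlam : 0 < lam) (hα : 0 < α) (hΓ : 0 < Γ) {s : ℝ}
    (hs : 0 < s) (hs1 : s ≤ 1) {N : ℕ} (hN : 1 ≤ N) :
    missProb P α Γ X N ≤ ENNReal.ofReal ((N : ℝ) ^ (-s)) *
      ∫⁻ ω, expE (ENNReal.ofReal s * logLoss α Γ Set.univ fun j => X j ω) ∂P := by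
  rw [← lintegral_const_mul'' (f := fun ω =>
    expE (ENNReal.ofReal s * logLoss α Γ Set.univ fun j => X j ω)) _ (measurable_expE.comp_aemeasurable
    ((aemeasurable_logLoss hX hlam hα hΓ).const_mul _))]
  exact lintegral_mono fun ω => one_sub_inv_expE_pow_le hs hs1 hN _

lemma meanCycles_antitone (hX : IsPoissonProcess P lam X) (hF : IsRayleighFading P X F)
    (hlam : 0 < lam) (hC : 0 < C) (hα : 0 < α) (hΓ : 0 < Γ) {M₁ M₂ : ℕ} (h1 : 1 ≤ M₁)
    (h12 : M₁ ≤ M₂) : meanCycles C α Γ X F P M₂ ≤ meanCycles C α Γ X F P M₁ := by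
  rw [meanCycles_eq_tsum_missProb hX hF hlam hC hα hΓ h1,
    meanCycles_eq_tsum_missProb hX hF hlam hC hα hΓ (h1.trans h12)]
  exact ENNReal.tsum_le_tsum fun N => pow_le_pow_right_of_le_one' (missProb_le_one N) h12

lemma meanCycles_one (hX : IsPoissonProcess P lam X) (hF : IsRayleighFading P X F)
    (hlam : 0 < lam) (hC : 0 < C) (hα : 0 < α) (hΓ : 0 < Γ) :
    meanCycles C α Γ X F P 1 = ∫⁻ ω, expE (logLoss α Γ Set.univ fun j => X j ω) ∂P := by
  rw [meanCycles_eq_tsum_missProb hX hF hlam hC hα hΓ le_rfl, ← tsum_missProb hX hlam hα hΓ]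
  simp

lemma meanCycles_two_eq_top (hX : IsPoissonProcess P lam X) (hF : IsRayleighFading P X F)
    (hlam : 0 < lam) (hC : 0 < C) (hΓ : 0 < Γ) {M : ℕ} (hM : 1 ≤ M) :
    meanCycles C 2 Γ X F P M = ∞ := by
  rw [meanCycles_eq_tsum_missProb hX hF hlam hC two_pos hΓ hM]
  simp_rw [missProb_two hX hlam hΓ, one_pow]
  exact ENNReal.tsum_const_eq_top_of_ne_zero one_ne_zero

lemma meanCycles_lt_top_of_lt (hX : IsPoissonProcess P lam X) (hF : IsRayleighFading P X F)
    (hlam : 0 < lam) (hC : 0 < C) (hα : 2 < α) (hΓ : 0 < Γ) {M : ℕ} (hM1 : 1 < M)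
    (hM : 2 * Γ / (α - 2) < M) : meanCycles C α Γ X F P M < ∞ := by
  have hα2 : 0 < α - 2 := by linarith
  have hM0 : (1 : ℝ) < M := by exact_mod_cast hM1
  -- The bound `1/M < s` makes `∑ N^{-sM}` converge; `s < 1` and `s < (α - 2)/(2Γ)` make the `s`-th
  -- exponential moment finite.
  obtain ⟨s, hs1, hs2⟩ : ∃ s : ℝ, 1 / (M : ℝ) < s ∧ s < min 1 ((α - 2) / (2 * Γ)) := by
    refine exists_between (lt_min ?_ ?_)
    · rw [div_lt_one (by linarith)]; exact hM0
    · rw [div_lt_div_iff₀ (by linarith) (by linarith), one_mul]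
      rw [div_lt_iff₀ hα2] at hM
      linarith
  have hs0 : 0 < s := lt_trans (by positivity) hs1
  have hs3 : s ≤ 1 := (hs2.trans_le (min_le_left _ _)).le
  have hs4 : s * Γ < α / 2 - 1 := by
    have := hs2.trans_le (min_le_right _ _)
    rw [lt_div_iff₀ (by linarith)] at this
    linarith
  have hI := lintegral_expE_logLoss_lt_top hX hlam hα hΓ hs0 hs3 hs4
  set I := ∫⁻ ω, expE (ENNReal.ofReal s * logLoss α Γ Set.univ fun j => X j ω) ∂P
  rw [meanCycles_eq_tsum_missProb hX hF hlam hC (by linarith) hΓ hM1.le]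
  have hsM : 1 < s * M := by rwa [div_lt_iff₀ (by linarith)] at hs1
  have hle : ∀ N : ℕ, missProb P α Γ X (N + 1) ^ M ≤
      ENNReal.ofReal (((N + 1 : ℕ) : ℝ) ^ (-(s * M))) * I ^ M := fun N => by
    refine (pow_le_pow_left' (missProb_le hX hlam (by linarith) hΓ hs0 hs3
      (Nat.le_add_left 1 N)) M).trans (le_of_eq ?_)
    rw [mul_pow, ← ENNReal.ofReal_pow (by positivity), ← Real.rpow_natCast,
      ← Real.rpow_mul (by positivity), neg_mul]
  -- The polynomial bound holds only for `N ≥ 1`, so the term `N = 0` is split off.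
  rw [tsum_eq_zero_add' ENNReal.summable]
  refine ENNReal.add_lt_top.2 ⟨(pow_le_one' (missProb_le_one 0) M).trans_lt ENNReal.one_lt_top, ?_⟩
  refine (ENNReal.tsum_le_tsum hle).trans_lt ?_
  rw [ENNReal.tsum_mul_right]
  refine ENNReal.mul_lt_top ?_ (ENNReal.pow_lt_top hI)
  have hsum : Summable fun N : ℕ => (N : ℝ) ^ (-(s * M)) :=
    Real.summable_nat_rpow.2 (by linarith)
  exact ((summable_nat_add_iff 1).2 hsum).tsum_ofReal_lt_top

end

end CellSearch

end

/-! ### The theorem -/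

theorem mainTheorem1 {Ω : Type*} [MeasurableSpace Ω] (P : Measure Ω) [IsProbabilityMeasure P]
    (lam C α Γ : ℝ) (hlam : 0 < lam) (hC : 0 < C) (hα : 2 ≤ α) (hΓ : 0 < Γ)
    (X : ℕ → Ω → ℂ) (F : ℕ → ℕ → Ω → ℝ)
    (hX : CellSearch.IsPoissonProcess P lam X)
    (hF : CellSearch.IsRayleighFading P X F) :
    (∀ M₁ M₂ : ℕ, 1 ≤ M₁ → M₁ ≤ M₂ →
      CellSearch.meanCycles C α Γ X F P M₂ ≤ CellSearch.meanCycles C α Γ X F P M₁) ∧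
    (2 + 2 * Γ < α → ∀ M : ℕ, 1 ≤ M → CellSearch.meanCycles C α Γ X F P M < ∞) ∧
    (α ≤ 2 + 2 * Γ →
      CellSearch.meanCycles C α Γ X F P 1 = ∞ ∧
      (2 < α →
        (∀ M : ℕ, 2 * Γ / (α - 2) < M → CellSearch.meanCycles C α Γ X F P M < ∞) ∧
        ∃ Mstar : ℕ, 1 ≤ Mstar ∧ (Mstar : ℝ) ≤ 2 * Γ / (α - 2) ∧
          (∀ M : ℕ, 1 ≤ M → M ≤ Mstar → CellSearch.meanCycles C α Γ X F P M = ∞) ∧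
          (∀ M : ℕ, Mstar < M → CellSearch.meanCycles C α Γ X F P M < ∞)) ∧
      (α = 2 → ∀ M : ℕ, 1 ≤ M → CellSearch.meanCycles C α Γ X F P M = ∞)) := by
  have hα0 : 0 < α := by linarith
  have hanti : ∀ M₁ M₂ : ℕ, 1 ≤ M₁ → M₁ ≤ M₂ →
      CellSearch.meanCycles C α Γ X F P M₂ ≤ CellSearch.meanCycles C α Γ X F P M₁ :=
    fun M₁ M₂ h1 h12 => CellSearch.meanCycles_antitone hX hF hlam hC hα0 hΓ h1 h12
  have htwo : α = 2 → ∀ M : ℕ, 1 ≤ M → CellSearch.meanCycles C α Γ X F P M = ∞ := by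
    rintro rfl M hM
    exact CellSearch.meanCycles_two_eq_top hX hF hlam hC hΓ hM
  refine ⟨hanti, fun h M hM => (hanti 1 M le_rfl hM).trans_lt ?_, fun h => ?_⟩
  · rw [CellSearch.meanCycles_one hX hF hlam hC hα0 hΓ]
    have := CellSearch.lintegral_expE_logLoss_lt_top hX hlam (by linarith) hΓ one_pos le_rfl
      (by linarith : 1 * Γ < α / 2 - 1)
    simpa using this
  have hone : CellSearch.meanCycles C α Γ X F P 1 = ∞ := by
    rcases hα.eq_or_lt with h2 | h2
    · exact htwo h2.symm 1 le_rfl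
    · rw [CellSearch.meanCycles_one hX hF hlam hC hα0 hΓ]
      exact CellSearch.lintegral_expE_logLoss_eq_top hX hlam h2 hΓ (by linarith)
  refine ⟨hone, fun h2 => ?_, htwo⟩
  have hα2 : 0 < α - 2 := by linarith
  have hfin : ∀ M : ℕ, 2 * Γ / (α - 2) < M → CellSearch.meanCycles C α Γ X F P M < ∞ := by
    intro M hM
    have hge : 1 ≤ 2 * Γ / (α - 2) := by rw [le_div_iff₀ hα2]; linarith
    exact CellSearch.meanCycles_lt_top_of_lt hX hF hlam hC h2 hΓ
      (by exact_mod_cast hge.trans_lt hM) hM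
  refine ⟨hfin, ?_⟩
  classical
  obtain ⟨n, hn⟩ := exists_nat_gt (2 * Γ / (α - 2))
  -- Searching for the least `M` whose successor has finite mean makes the minimiser itself the last
  -- number of beams with infinite mean.
  have hex : ∃ M : ℕ, CellSearch.meanCycles C α Γ X F P (M + 1) < ∞ :=
    ⟨n, hfin _ (hn.trans_le (by push_cast; linarith))⟩
  have hspec := Nat.find_spec hex
  have htop : ∀ M : ℕ, 1 ≤ M → M ≤ Nat.find hex → CellSearch.meanCycles C α Γ X F P M = ∞ := by
    intro M hM1 hM
    obtain ⟨m, rfl⟩ : ∃ m, M = m + 1 := ⟨M - 1, by omega⟩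
    exact not_lt_top_iff.1 (Nat.find_min hex (by omega : m < Nat.find hex))
  have hpos : 1 ≤ Nat.find hex := by
    rw [Nat.one_le_iff_ne_zero]
    intro h0
    rw [h0, zero_add, hone] at hspec
    exact lt_irrefl _ hspec
  refine ⟨Nat.find hex, hpos, ?_, htop, fun M hM => (hanti _ M (by omega) hM).trans_lt hspec⟩
  -- Above `2Γ/(α - 2)` the mean is finite, whereas at the minimiser it is infinite.
  by_contra hlt
  exact (hfin _ (not_le.1 hlt)).ne (htop _ hpos le_rfl)
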